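/- Consider two qubits, with state space $\mathbb C^2\otimes\mathbb C^2$. Let $\mathcal P=\sigma_y\otimes\sigma_y$, let $\mathcal T=\mathcal K$ be entrywise complex conjugation in the standard basis, and let $\mathcal{PT}\rho\,\mathcal{PT}$ denote the composition of operators. All logarithms are to base 2. For a state (density matrix) $\rho$ define $$\Gamma_s(\rho)=1-\mathrm{Tr}\big(\rho^{1/2}\,\mathcal{PT}\rho^{1/2}\mathcal{PT}\big),\qquad \Gamma_F(\rho)=1-\mathrm{Tr}\sqrt{\sqrt\rho\,(\mathcal{PT}\rho\,\mathcal{PT})\sqrt\rho},\qquad \Gamma_r(\rho)=\min_\sigma S(\rho\|\sigma),$$ where $\sigma$ runs over the states with $\mathcal{PT}\sigma\,\mathcal{PT}=\sigma$, and $S(\rho\|\sigma)=\mathrm{Tr}\,\rho\log\rho-\mathrm{Tr}\,\rho\log\sigma$ ($+\infty$ if the support of $\rho$ is not contained in that of $\sigma$). For a unit vector $\Psi$ let $C(\Psi)=|\langle\Psi|\sigma_y\otimes\sigma_y\mathcal K|\Psi\rangle|$ be the concurrence, and for a state $\rho$ let $$C(\rho)=\min\sum_kp_kC(\Psi_k),\qquad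 CoA(\rho)=\max\sum_kp_kC(\Psi_k)$$ be its concurrence and its concurrence of assistance, the extrema being over all finite decompositions $\rho=\sum_kp_k|\Psi_k\rangle\langle\Psi_k|$ into pure states with $p_k\ge0$, $\sum_kp_k=1$. Let $H(p)=-p\log p-(1-p)\log(1-p)$, with $0\log0=0$. For every pure state $\Psi$ (writing $\Gamma(\Psi)=\Gamma(|\Psi\rangle\langle\Psi|)$), $$\Gamma_s(\Psi)+C(\Psi)^2=1,\qquad \Gamma_F(\Psi)+C(\Psi)=1,\qquad \Gamma_r(\Psi)=H\big(\tfrac12-\tfrac12C(\Psi)\big).$$ For every state $\rho$ the minima and the maximum above are attained, and $$\Gamma_s(\rho)+C(\rho)^2\le1,\qquad \Gamma_F(\rho)+C(\rho)\le1,\qquad \Gamma_r(\rho)\le H\big(\tfrac12-\tfrac12C(\rho)\big),$$ and moreover $$\Gamma_F(\rho)+CoA(\rho)=1.$$ The three inequalities need not be equalities: there is a state for which all three are strict. -/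

import Mathlib

open scoped Kronecker MatrixOrder ComplexOrder

namespace PTAsym

section General

variable {n : Type*} [Fintype n] [DecidableEq n]

/-- Unit vectors, i.e. (representatives of) pure states. -/
def IsUnitVec (ψ : n → ℂ) : Prop := star ψ ⬝ᵥ ψ = 1

/-- Density matrices, i.e. (mixed or pure) quantum states. -/
def IsState (ρ : Matrix n n ℂ) : Prop := ρ.PosSemidef ∧ ρ.trace = 1

/-- The rank-one projection `|ψ⟩⟨ψ|`. -/
def proj (ψ : n → ℂ) : Matrix n n ℂ := Matrix.vecMulVec ψ (star ψ)

/-- The antilinear operator `PT` on vectors, where `T = U K` and `K` is the entrywise complex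
conjugation. -/
def ptApply (P U : Matrix n n ℂ) (ψ : n → ℂ) : n → ℂ :=
  Matrix.mulVec P (Matrix.mulVec U (star ψ))

/-- The matrix of the linear operator `PT A PT` (composition of maps). -/
def ptConj (P U A : Matrix n n ℂ) : Matrix n n ℂ :=
  (P * U) * A.map star * (P * U).map star

theorem map_star_mul {n : Type*} [Fintype n] (A B : Matrix n n ℂ) :
    (A * B).map star = A.map star * B.map star := by
  ext i j
  simp [Matrix.mul_apply]

/-- `ptConj` is the composition of `PT`, `A` and `PT`. -/
theorem ptConj_mulVec {n : Type*} [Fintype n] (P U A : Matrix n n ℂ) (v : n → ℂ) :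
    Matrix.mulVec (ptConj P U A) v = ptApply P U (Matrix.mulVec A (ptApply P U v)) := by
  have h : ∀ (B : Matrix n n ℂ) (w : n → ℂ),
      star (Matrix.mulVec B w) = Matrix.mulVec (B.map star) (star w) := by
    intro B w
    ext i
    simp [Matrix.mulVec, dotProduct]
  simp only [ptConj, ptApply, h, star_star, Matrix.mulVec_mulVec, Matrix.mul_assoc, map_star_mul]

/-- With `V = P U`, an antilinear operator `M K` has square `M * M.map star`, and the antilinear
commutator of the linear operator `r` with `PT = V K` is `M K` for `M = r V - V r.map star`. So
this reads `-(1/2) Tr [√ρ, PT]^2 = 1 - Tr (√ρ PT √ρ PT)` when `r = √ρ` and `PT` is an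
involution. -/
theorem skew_eq {n : Type*} [Fintype n] [DecidableEq n] (P U ρ r : Matrix n n ℂ)
    (hρ : IsState ρ) (hr : r * r = ρ) (hV : (P * U) * (P * U).map star = 1) :
    -(1 / 2 : ℂ) * ((r * (P * U) - (P * U) * r.map star) *
        (r * (P * U) - (P * U) * r.map star).map star).trace
      = 1 - (r * ptConj P U r).trace := by
  unfold ptConj
  generalize P * U = V at *
  have hW := mul_eq_one_comm.mp hV
  have h1 : (r * V - V * r.map star).map star = r.map star * V.map star - V.map star * r := by
    have h2 : (r.map star).map star = r := by ext; simp
    have h3 : ∀ A B : Matrix n n ℂ, (A - B).map star = A.map star - B.map star := by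
      intro A B; ext; simp
    rw [h3, map_star_mul, map_star_mul, h2]
  have e : (r * V - V * r.map star) * (r.map star * V.map star - V.map star * r)
      = r * (V * r.map star * V.map star) - r * (V * V.map star) * r
        - V * (r * r).map star * V.map star + (V * r.map star * V.map star) * r := by
    rw [map_star_mul]; noncomm_ring
  have t1 : (V * (r * r).map star * V.map star).trace = 1 := by
    rw [Matrix.trace_mul_comm, ← Matrix.mul_assoc, hW, Matrix.one_mul, hr]
    have := congrArg star hρ.2
    simpa [Matrix.trace] using this
  rw [h1, e, Matrix.trace_add, Matrix.trace_sub, Matrix.trace_sub, t1, hV, Matrix.mul_one, hr,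
    hρ.2, Matrix.trace_mul_comm (V * r.map star * V.map star) r]
  ring

/-- The states that are invariant under `PT`. -/
def symStates (P U : Matrix n n ℂ) : Set (Matrix n n ℂ) :=
  {σ | IsState σ ∧ ptConj P U σ = σ}

/-- The base 2 logarithm of a Hermitian matrix, with eigenvalue `0` sent to `0`, so that
`A * log2 A` follows the convention `0 log 0 = 0`. -/
noncomputable def log2 (A : Matrix n n ℂ) : Matrix n n ℂ := cfc (Real.logb 2) A

open Classical in
/-- Quantum relative entropy `S(ρ‖σ) = Tr ρ log ρ - Tr ρ log σ`, equal to `+∞` when the support of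
`ρ` is not contained in that of `σ`. -/
noncomputable def relEntropy (ρ σ : Matrix n n ℂ) : EReal :=
  if ∀ v : n → ℂ, Matrix.mulVec σ v = 0 → Matrix.mulVec ρ v = 0 then
    (((ρ * log2 ρ).trace.re - (ρ * log2 σ).trace.re : ℝ) : EReal)
  else ⊤

/-- Relative entropy of `PT`-asymmetry. -/
noncomputable def gammaR (P U ρ : Matrix n n ℂ) : EReal :=
  ⨅ σ ∈ symStates P U, relEntropy ρ σ

/-- Skew information of `PT`-asymmetry. -/
noncomputable def gammaS (P U ρ : Matrix n n ℂ) : ℝ :=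
  1 - (CFC.sqrt ρ * ptConj P U (CFC.sqrt ρ)).trace.re

/-- Fidelity `F(ρ, σ) = Tr √(√ρ σ √ρ)`. -/
noncomputable def fidelity (ρ σ : Matrix n n ℂ) : ℝ :=
  (CFC.sqrt (CFC.sqrt ρ * σ * CFC.sqrt ρ)).trace.re

/-- Fidelity measure of `PT`-asymmetry. -/
noncomputable def gammaF (P U ρ : Matrix n n ℂ) : ℝ :=
  1 - fidelity ρ (ptConj P U ρ)

/-- `ρ = ∑ k, p k |Ψ k⟩⟨Ψ k|` is a decomposition of `ρ` into finitely many pure states. -/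
def IsDecomposition (ρ : Matrix n n ℂ) {m : ℕ} (p : Fin m → ℝ) (Ψ : Fin m → n → ℂ) : Prop :=
  (∀ k, 0 ≤ p k) ∧ ∑ k, p k = 1 ∧ (∀ k, IsUnitVec (Ψ k)) ∧ ρ = ∑ k, (p k : ℂ) • proj (Ψ k)

end General

/-- Binary Shannon entropy, in bits. -/
noncomputable def binH (p : ℝ) : ℝ := -p * Real.logb 2 p - (1 - p) * Real.logb 2 (1 - p)

/-- The Pauli matrix `σ_y`. -/
def sigmaY : Matrix (Fin 2) (Fin 2) ℂ := !![0, -Complex.I; Complex.I, 0]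

/-- `σ_y ⊗ σ_y`. -/
def sigmaYY : Matrix (Fin 2 × Fin 2) (Fin 2 × Fin 2) ℂ := sigmaY ⊗ₖ sigmaY

/-- Concurrence `|⟨Ψ| (σ_y ⊗ σ_y) K |Ψ⟩|` of a two-qubit pure state. -/
noncomputable def concurrence (Ψ : Fin 2 × Fin 2 → ℂ) : ℝ :=
  ‖star Ψ ⬝ᵥ Matrix.mulVec sigmaYY (star Ψ)‖

/-- The average concurrences `∑ k, p k * C(Ψ k)` over all pure state decompositions of `ρ`. -/
def avgConcurrences (ρ : Matrix (Fin 2 × Fin 2) (Fin 2 × Fin 2) ℂ) : Set ℝ :=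
  {x | ∃ (m : ℕ) (p : Fin m → ℝ) (Ψ : Fin m → Fin 2 × Fin 2 → ℂ),
    IsDecomposition ρ p Ψ ∧ x = ∑ k, p k * concurrence (Ψ k)}

/-- Concurrence of a mixed two-qubit state: the least average concurrence. -/
noncomputable def mixedConcurrence (ρ : Matrix (Fin 2 × Fin 2) (Fin 2 × Fin 2) ℂ) : ℝ :=
  sInf (avgConcurrences ρ)

/-- Concurrence of assistance: the greatest average concurrence. -/
noncomputable def concurrenceOfAssistance
    (ρ : Matrix (Fin 2 × Fin 2) (Fin 2 × Fin 2) ℂ) : ℝ :=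
  sSup (avgConcurrences ρ)

end PTAsym

open PTAsym

/-! Write θ = (σ_y ⊗ σ_y)K, an antiunitary involution, so that C(ψ) = |⟨ψ|θψ⟩|. Let t_i, e_i be the
eigenvalues and eigenvectors of ρ; the spectral decomposition gives C(ρ) ≤ ∑ t_i C(e_i).

Skew information: Tr(√ρ θ√ρθ) = ∑ √(t_i t_j) |⟨e_i|θe_j⟩|². Its diagonal part is ∑ t_i C(e_i)²,
which is at least (∑ t_i C(e_i))² by convexity (`gammaS_add_sq_le`).

Relative entropy: Tr ρ log σ does not change when ρ is replaced by τ = (ρ + θρθ)/2, if σ is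
invariant. Klein's inequality then makes τ the minimizer, with value S(τ) - S(ρ), where S(τ) = -Tr τ
log τ. A unit vector is, up to phase, a + ib with a, b fixed by θ, orthogonal and of squared norms
(1 ± C)/2 (`exists_real_imag_parts`); this settles pure states. For mixed states the e_i are split
in this way, `mul_logb_le_dotProduct_log2` bounds S(τ) by the Shannon entropy of the weights t_i(1 ±
C(e_i))/2, and concavity and monotonicity of H finish (`gammaR_le`).

Fidelity: members of a decomposition have the form √ρ v, and C(√ρ v) = |vᵀMv| for the complex
symmetric M = √ρᵀ(σ_y ⊗ σ_y)√ρ. A real form of Takagi's factorization (`exists_coneigenvectors`)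
shows that the largest average is the trace norm of M, which is the fidelity
(`isGreatest_avgConcurrences`). The inequality for Γ_F follows because the minimum is at most the
maximum.

The least average is attained because the pairs (C(ψ), |ψ⟩⟨ψ|) form a compact set, whose convex hull
is compact. The maximally mixed state makes all three inequalities strict: every Γ and C vanish
there. -/

namespace PTAsym

/-! ### Spectral decompositions and functional calculus of Hermitian matrices -/

section Spectral

variable {n : Type*} [Fintype n] [DecidableEq n]

theorem proj_mulVec {n : Type*} [Fintype n] (ψ v : n → ℂ) :
    (proj ψ).mulVec v = (star ψ ⬝ᵥ v) • ψ := by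
  ext i
  simp [proj, Matrix.mulVec, dotProduct, Matrix.vecMulVec_apply, Finset.mul_sum, mul_comm,
    mul_left_comm]

theorem trace_mul_proj {n : Type*} [Fintype n] (B : Matrix n n ℂ) (ψ : n → ℂ) :
    (B * proj ψ).trace = star ψ ⬝ᵥ B.mulVec ψ := by
  rw [proj, Matrix.mul_vecMulVec, Matrix.trace_vecMulVec, dotProduct_comm]

theorem star_dotProduct_comm {n : Type*} [Fintype n] (v w : n → ℂ) :
    star v ⬝ᵥ w = star (star w ⬝ᵥ v) := by
  simp [dotProduct, mul_comm]

theorem conj_mul_dotProduct {n : Type*} [Fintype n] (v w : n → ℂ) :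
    (star v ⬝ᵥ w) * (star w ⬝ᵥ v) = ((‖star w ⬝ᵥ v‖ ^ 2 : ℝ) : ℂ) := by
  rw [star_dotProduct_comm v w]
  have := Complex.conj_mul' (star w ⬝ᵥ v)
  simpa using this

theorem proj_posSemidef {n : Type*} [Fintype n] (ψ : n → ℂ) : (proj ψ).PosSemidef :=
  Matrix.posSemidef_vecMulVec_self_star ψ

theorem proj_smul {n : Type*} (c : ℂ) (ψ : n → ℂ) :
    proj (c • ψ) = ((‖c‖ ^ 2 : ℝ) : ℂ) • proj ψ := by
  ext i j
  have := Complex.mul_conj' c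
  simp only [proj, Matrix.vecMulVec_apply, Pi.smul_apply, Pi.star_apply, smul_eq_mul, star_mul',
    Matrix.smul_apply, Complex.ofReal_pow, ← this, RCLike.star_def]
  ring

/-- `t` and `e` are the eigenvalues and an orthonormal basis of eigenvectors of `A`. -/
structure IsSpectral (A : Matrix n n ℂ) (t : n → ℝ) (e : n → n → ℂ) : Prop where
  orth : ∀ i j, star (e i) ⬝ᵥ e j = if i = j then 1 else 0
  complete : ∑ i, proj (e i) = 1
  cfc_eq : ∀ f : ℝ → ℝ, cfc f A = ∑ i, (f (t i) : ℂ) • proj (e i)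
  eq : A = ∑ i, (t i : ℂ) • proj (e i)

theorem exists_isSpectral {A : Matrix n n ℂ} (hA : A.IsHermitian) :
    ∃ t e, IsSpectral A t e := by
  have key : ∀ f : ℝ → ℝ, cfc f A = ∑ i, (f (hA.eigenvalues i) : ℂ) •
      proj (fun a => (hA.eigenvectorUnitary : Matrix n n ℂ) a i) := by
    intro f
    rw [hA.cfc_eq, Matrix.IsHermitian.cfc, Unitary.conjStarAlgAut_apply]
    ext a b
    simp [Matrix.mul_apply, Matrix.sum_apply, proj, Matrix.vecMulVec_apply, Matrix.diagonal_apply,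
      Matrix.star_apply, mul_comm, mul_assoc]
  refine ⟨hA.eigenvalues, fun i a => (hA.eigenvectorUnitary : Matrix n n ℂ) a i, ?_, ?_, key, ?_⟩
  · intro i j
    have := congrFun (congrFun (Unitary.coe_star_mul_self hA.eigenvectorUnitary) i) j
    rw [Matrix.one_apply] at this
    rw [← this]
    simp [Matrix.mul_apply, dotProduct, Matrix.star_apply]
  · have h := Unitary.coe_mul_star_self hA.eigenvectorUnitary
    rw [← h]
    ext a b
    simp [Matrix.mul_apply, Matrix.sum_apply, proj, Matrix.vecMulVec_apply, Matrix.star_apply]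
  · rw [← key (fun x => x)]
    exact (cfc_id' ℝ A hA).symm

theorem sum_smul_proj_mulVec {ι n : Type*} [Fintype n] [Fintype ι] (c : ι → ℂ) (e : ι → n → ℂ)
    (v : n → ℂ) :
    (∑ i, c i • proj (e i)).mulVec v = ∑ i, (c i * (star (e i) ⬝ᵥ v)) • e i := by
  rw [Matrix.sum_mulVec]
  simp [Matrix.smul_mulVec, proj_mulVec, smul_smul]

theorem dotProduct_sum_smul_proj_mulVec {ι n : Type*} [Fintype n] [Fintype ι] (c : ι → ℝ)
    (e : ι → n → ℂ) (v : n → ℂ) :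
    star v ⬝ᵥ (∑ i, (c i : ℂ) • proj (e i)).mulVec v
      = ((∑ i, c i * ‖star (e i) ⬝ᵥ v‖ ^ 2 : ℝ) : ℂ) := by
  rw [sum_smul_proj_mulVec, dotProduct_sum]
  push_cast
  refine Finset.sum_congr rfl fun i _ => ?_
  have := conj_mul_dotProduct v (e i)
  push_cast at this
  rw [dotProduct_smul, smul_eq_mul, ← this]
  ring

namespace IsSpectral

variable {A : Matrix n n ℂ} {t : n → ℝ} {e : n → n → ℂ}

theorem isUnitVec (h : IsSpectral A t e) (i : n) : IsUnitVec (e i) := by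
  simp [IsUnitVec, h.orth]

theorem expand (h : IsSpectral A t e) (v : n → ℂ) : v = ∑ i, (star (e i) ⬝ᵥ v) • e i := by
  have := sum_smul_proj_mulVec (fun _ => 1) e v
  simpa [h.complete] using this

theorem ext_mulVec (h : IsSpectral A t e) {B C : Matrix n n ℂ}
    (hBC : ∀ i, B.mulVec (e i) = C.mulVec (e i)) : B = C := by
  apply Matrix.ext_of_mulVec_single
  intro j
  rw [h.expand (Pi.single j 1), Matrix.mulVec_sum, Matrix.mulVec_sum]
  simp [Matrix.mulVec_smul, hBC]

theorem cfc_mulVec_eigenvector (h : IsSpectral A t e) (f : ℝ → ℝ) (i : n) :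
    (cfc f A).mulVec (e i) = (f (t i) : ℂ) • e i := by
  rw [h.cfc_eq, sum_smul_proj_mulVec, Finset.sum_eq_single i]
  · simp [h.orth]
  · intro j _ hj
    simp [h.orth, hj]
  · simp

theorem mulVec_eigenvector (h : IsSpectral A t e) (i : n) :
    A.mulVec (e i) = (t i : ℂ) • e i := by
  conv_lhs => rw [h.eq]
  rw [sum_smul_proj_mulVec, Finset.sum_eq_single i]
  · simp [h.orth]
  · intro j _ hj
    simp [h.orth, hj]
  · simp

theorem cfc_quadForm (h : IsSpectral A t e) (f : ℝ → ℝ) (v : n → ℂ) :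
    star v ⬝ᵥ (cfc f A).mulVec v = ((∑ i, f (t i) * ‖star (e i) ⬝ᵥ v‖ ^ 2 : ℝ) : ℂ) := by
  rw [h.cfc_eq]
  exact dotProduct_sum_smul_proj_mulVec (fun i => f (t i)) e v

theorem quadForm (h : IsSpectral A t e) (v : n → ℂ) :
    star v ⬝ᵥ A.mulVec v = ((∑ i, t i * ‖star (e i) ⬝ᵥ v‖ ^ 2 : ℝ) : ℂ) := by
  conv_lhs => rw [h.eq]
  exact dotProduct_sum_smul_proj_mulVec t e v

theorem sum_norm_sq (h : IsSpectral A t e) (v : n → ℂ) :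
    star v ⬝ᵥ v = ((∑ i, ‖star (e i) ⬝ᵥ v‖ ^ 2 : ℝ) : ℂ) := by
  have := dotProduct_sum_smul_proj_mulVec (fun _ => 1) e v
  simpa [h.complete] using this

theorem trace_mul_cfc (h : IsSpectral A t e) (B : Matrix n n ℂ) (f : ℝ → ℝ) :
    (B * cfc f A).trace = ∑ i, (f (t i) : ℂ) * (star (e i) ⬝ᵥ B.mulVec (e i)) := by
  rw [h.cfc_eq, Matrix.mul_sum, Matrix.trace_sum]
  simp [trace_mul_proj]

theorem trace_eq (h : IsSpectral A t e) : A.trace = ((∑ i, t i : ℝ) : ℂ) := by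
  conv_lhs => rw [h.eq]
  rw [Matrix.trace_sum]
  push_cast
  refine Finset.sum_congr rfl fun i _ => ?_
  have := trace_mul_proj (1 : Matrix n n ℂ) (e i)
  rw [Matrix.one_mul, Matrix.one_mulVec, h.isUnitVec i] at this
  rw [Matrix.trace_smul, this, smul_eq_mul, mul_one]

theorem nonneg (h : IsSpectral A t e) (hA : A.PosSemidef) (i : n) : 0 ≤ t i := by
  have := hA.dotProduct_mulVec_nonneg (e i)
  rw [h.mulVec_eigenvector, dotProduct_smul, h.isUnitVec i, smul_eq_mul, mul_one] at this
  exact_mod_cast this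

theorem sum_eq_one (h : IsSpectral A t e) (hA : IsState A) : ∑ i, t i = 1 := by
  have := h.trace_eq
  rw [hA.2] at this
  exact_mod_cast this.symm

end IsSpectral

/-- The eigenvector need not belong to the chosen basis, and may be zero: its component along `e i`
vanishes unless `t i = μ`, as `A` is Hermitian. -/
theorem cfc_mulVec_of_eigenvector {A : Matrix n n ℂ} (hA : A.IsHermitian) {v : n → ℂ} {μ : ℝ}
    (hv : A.mulVec v = (μ : ℂ) • v) (f : ℝ → ℝ) : (cfc f A).mulVec v = (f μ : ℂ) • v := by
  obtain ⟨t, e, h⟩ := exists_isSpectral hA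
  have key : ∀ i, (t i : ℂ) * (star (e i) ⬝ᵥ v) = μ * (star (e i) ⬝ᵥ v) := by
    intro i
    have h1 : star (e i) ⬝ᵥ A.mulVec v = star (A.mulVec (e i)) ⬝ᵥ v := by
      rw [Matrix.star_mulVec, hA.eq, Matrix.dotProduct_mulVec]
    rw [hv, h.mulVec_eigenvector] at h1
    simpa [dotProduct_smul] using h1.symm
  rw [h.cfc_eq, sum_smul_proj_mulVec]
  conv_rhs => rw [h.expand v]
  rw [Finset.smul_sum]
  refine Finset.sum_congr rfl fun i _ => ?_
  rw [smul_smul]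
  by_cases h0 : star (e i) ⬝ᵥ v = 0
  · simp [h0]
  · have : t i = μ := by exact_mod_cast mul_right_cancel₀ h0 (key i)
    rw [this]

theorem isHermitian_cfc {A : Matrix n n ℂ} (f : ℝ → ℝ) : (cfc f A).IsHermitian :=
  cfc_predicate f A

theorem sqrt_eq_of_mul_self {A B : Matrix n n ℂ} (hB : B.PosSemidef) (h : B * B = A) :
    CFC.sqrt A = B :=
  CFC.sqrt_unique h hB.nonneg

theorem sqrt_posSemidef (A : Matrix n n ℂ) : (CFC.sqrt A).PosSemidef :=
  Matrix.nonneg_iff_posSemidef.mp (CFC.sqrt_nonneg A)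

theorem sqrt_mul_sqrt {A : Matrix n n ℂ} (hA : A.PosSemidef) : CFC.sqrt A * CFC.sqrt A = A :=
  CFC.sqrt_mul_sqrt_self A hA.nonneg

theorem cfc_posSemidef {A : Matrix n n ℂ} (f : ℝ → ℝ) (hf : ∀ x, 0 ≤ f x) :
    (cfc f A).PosSemidef :=
  Matrix.nonneg_iff_posSemidef.mp (cfc_nonneg fun x _ => hf x)

/-- The pointwise identity is needed only at the eigenvalues, and no continuity is asked. This
allows discontinuous functions such as `(Real.sqrt r)⁻¹`, used below for pseudo-inverses. -/
theorem IsSpectral.mul_cfc {A : Matrix n n ℂ} {t : n → ℝ} {e : n → n → ℂ} (h : IsSpectral A t e)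
    (f g k : ℝ → ℝ) (hk : ∀ i, f (t i) * g (t i) = k (t i)) : cfc f A * cfc g A = cfc k A := by
  refine h.ext_mulVec fun i => ?_
  rw [← Matrix.mulVec_mulVec]
  simp only [h.cfc_mulVec_eigenvector, Matrix.mulVec_smul, smul_smul]
  rw [← hk]
  push_cast
  rw [mul_comm]

theorem IsSpectral.sqrt_eq {A : Matrix n n ℂ} {t : n → ℝ} {e : n → n → ℂ} (h : IsSpectral A t e)
    (hA : A.PosSemidef) : CFC.sqrt A = cfc Real.sqrt A := by
  refine sqrt_eq_of_mul_self (cfc_posSemidef _ Real.sqrt_nonneg) ?_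
  rw [h.mul_cfc Real.sqrt Real.sqrt (fun x => x) fun i => Real.mul_self_sqrt (h.nonneg hA i)]
  exact cfc_id' ℝ A hA.1

end Spectral


/-! ### The spin flip, concurrence, and pure state decompositions -/

section SpinFlip

/-- Index type of the two-qubit standard basis. -/
abbrev Qubits := Fin 2 × Fin 2

theorem sigmaYY_map_star : sigmaYY.map star = sigmaYY := by
  ext ⟨i, j⟩ ⟨k, l⟩
  fin_cases i <;> fin_cases j <;> fin_cases k <;> fin_cases l <;>
    simp [sigmaYY, sigmaY, Matrix.kroneckerMap_apply]

theorem sigmaYY_transpose : sigmaYY.transpose = sigmaYY := by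
  ext ⟨i, j⟩ ⟨k, l⟩
  fin_cases i <;> fin_cases j <;> fin_cases k <;> fin_cases l <;>
    simp [sigmaYY, sigmaY, Matrix.kroneckerMap_apply]

theorem sigmaYY_mul_self : sigmaYY * sigmaYY = 1 := by
  have h : sigmaY * sigmaY = 1 := by
    ext i j
    fin_cases i <;> fin_cases j <;> simp [sigmaY, Matrix.mul_apply]
  rw [sigmaYY, ← Matrix.mul_kronecker_mul, h, Matrix.one_kronecker_one]

theorem sigmaYY_conjTranspose : sigmaYY.conjTranspose = sigmaYY := by
  rw [Matrix.conjTranspose, sigmaYY_transpose, sigmaYY_map_star]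

/-- The antiunitary involution `(σ_y ⊗ σ_y) K`. -/
def spinFlip (ψ : Qubits → ℂ) : Qubits → ℂ := sigmaYY.mulVec (star ψ)

theorem spinFlip_smul (c : ℂ) (ψ : Qubits → ℂ) : spinFlip (c • ψ) = star c • spinFlip ψ := by
  simp [spinFlip, Matrix.mulVec_smul]

theorem star_mulVec_sigmaYY (ψ : Qubits → ℂ) :
    star (sigmaYY.mulVec ψ) = sigmaYY.mulVec (star ψ) := by
  rw [Matrix.star_mulVec, sigmaYY_conjTranspose, ← Matrix.mulVec_transpose, sigmaYY_transpose]

theorem spinFlip_spinFlip (ψ : Qubits → ℂ) : spinFlip (spinFlip ψ) = ψ := by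
  rw [spinFlip, spinFlip, star_mulVec_sigmaYY, star_star, Matrix.mulVec_mulVec, sigmaYY_mul_self,
    Matrix.one_mulVec]

/-- This is the symmetry of σ_y ⊗ σ_y as a bilinear form; antiunitarity of the spin flip follows
from it. -/
theorem dotProduct_spinFlip_comm (ψ φ : Qubits → ℂ) :
    star ψ ⬝ᵥ spinFlip φ = star φ ⬝ᵥ spinFlip ψ := by
  rw [spinFlip, spinFlip, Matrix.dotProduct_mulVec, ← Matrix.mulVec_transpose, sigmaYY_transpose,
    dotProduct_comm]

theorem spinFlip_dotProduct_spinFlip (ψ φ : Qubits → ℂ) :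
    star (spinFlip ψ) ⬝ᵥ spinFlip φ = star φ ⬝ᵥ ψ := by
  rw [dotProduct_spinFlip_comm, spinFlip_spinFlip]

theorem concurrence_eq (ψ : Qubits → ℂ) : concurrence ψ = ‖star ψ ⬝ᵥ spinFlip ψ‖ := rfl

theorem concurrence_nonneg (ψ : Qubits → ℂ) : 0 ≤ concurrence ψ := norm_nonneg _

theorem concurrence_smul (c : ℂ) (ψ : Qubits → ℂ) :
    concurrence (c • ψ) = ‖c‖ ^ 2 * concurrence ψ := by
  rw [concurrence_eq, concurrence_eq, spinFlip_smul, star_smul, smul_dotProduct, dotProduct_smul]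
  simp [pow_two, mul_assoc]

theorem ptConj_sigmaYY (A : Matrix Qubits Qubits ℂ) :
    ptConj sigmaYY 1 A = sigmaYY * A.map star * sigmaYY := by
  simp only [ptConj, Matrix.mul_one, sigmaYY_map_star]

theorem ptConj_sigmaYY_mulVec (A : Matrix Qubits Qubits ℂ) (v : Qubits → ℂ) :
    (ptConj sigmaYY 1 A).mulVec v = spinFlip (A.mulVec (spinFlip v)) := by
  rw [ptConj_mulVec]
  simp [ptApply, spinFlip]

theorem ptConj_sigmaYY_mul (A B : Matrix Qubits Qubits ℂ) :
    ptConj sigmaYY 1 (A * B) = ptConj sigmaYY 1 A * ptConj sigmaYY 1 B := by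
  simp only [ptConj_sigmaYY, map_star_mul]
  calc _ = sigmaYY * A.map star * 1 * B.map star * sigmaYY := by simp [Matrix.mul_assoc]
    _ = _ := by rw [← sigmaYY_mul_self]; simp only [Matrix.mul_assoc]

theorem trace_ptConj_sigmaYY (A : Matrix Qubits Qubits ℂ) :
    (ptConj sigmaYY 1 A).trace = star A.trace := by
  rw [ptConj_sigmaYY, Matrix.trace_mul_comm, ← Matrix.mul_assoc, sigmaYY_mul_self, Matrix.one_mul]
  simp [Matrix.trace]

/-- For Hermitian `A` the entrywise conjugate is the transpose, which stays positive; what remains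
is a congruence by σ_y ⊗ σ_y. -/
theorem ptConj_sigmaYY_posSemidef {A : Matrix Qubits Qubits ℂ} (hA : A.PosSemidef) :
    (ptConj sigmaYY 1 A).PosSemidef := by
  have h : A.map star = A.transpose := by
    conv_lhs => rw [← hA.1.eq]
    ext; simp
  have := hA.transpose.conjTranspose_mul_mul_same sigmaYY
  rwa [sigmaYY_conjTranspose, ← h, ← ptConj_sigmaYY] at this

theorem ptConj_sigmaYY_add (A B : Matrix Qubits Qubits ℂ) :
    ptConj sigmaYY 1 (A + B) = ptConj sigmaYY 1 A + ptConj sigmaYY 1 B := by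
  simp [ptConj_sigmaYY, Matrix.map_add, Matrix.mul_add, Matrix.add_mul]

theorem ptConj_sigmaYY_smul (c : ℝ) (A : Matrix Qubits Qubits ℂ) :
    ptConj sigmaYY 1 ((c : ℂ) • A) = (c : ℂ) • ptConj sigmaYY 1 A := by
  have : ((c : ℂ) • A).map star = (c : ℂ) • A.map star := by ext; simp
  rw [ptConj_sigmaYY, this, ptConj_sigmaYY, Matrix.mul_smul, Matrix.smul_mul]

theorem ptConj_sigmaYY_ptConj (A : Matrix Qubits Qubits ℂ) :
    ptConj sigmaYY 1 (ptConj sigmaYY 1 A) = A := by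
  apply Matrix.ext_of_mulVec_single
  intro j
  simp only [ptConj_sigmaYY_mulVec, spinFlip_spinFlip]

theorem ptConj_sigmaYY_sum {ι : Type*} [Fintype ι] (c : ι → ℝ)
    (A : ι → Matrix Qubits Qubits ℂ) :
    ptConj sigmaYY 1 (∑ i, (c i : ℂ) • A i) = ∑ i, (c i : ℂ) • ptConj sigmaYY 1 (A i) := by
  let F : Matrix Qubits Qubits ℂ →+ Matrix Qubits Qubits ℂ :=
    { toFun := ptConj sigmaYY 1
      map_zero' := by simp [ptConj_sigmaYY]
      map_add' := ptConj_sigmaYY_add }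
  refine (map_sum F (fun i => (c i : ℂ) • A i) Finset.univ).trans ?_
  exact Finset.sum_congr rfl fun i _ => ptConj_sigmaYY_smul (c i) (A i)

theorem ptConj_sigmaYY_proj (ψ : Qubits → ℂ) :
    ptConj sigmaYY 1 (proj ψ) = proj (spinFlip ψ) := by
  apply Matrix.ext_of_mulVec_single
  intro j
  rw [ptConj_sigmaYY_mulVec, proj_mulVec, proj_mulVec, spinFlip_smul,
    ← star_dotProduct_comm, ← spinFlip_dotProduct_spinFlip, spinFlip_spinFlip]

/-- A pure state splits into the real and the imaginary part with respect to the spin flip; after a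
change of phase these are orthogonal. -/
theorem exists_real_imag_parts {ψ : Qubits → ℂ} (hψ : IsUnitVec ψ) :
    ∃ a b : Qubits → ℂ, star a ⬝ᵥ b = 0 ∧
      star a ⬝ᵥ a = (((1 + concurrence ψ) / 2 : ℝ) : ℂ) ∧
      star b ⬝ᵥ b = (((1 - concurrence ψ) / 2 : ℝ) : ℂ) ∧
      (1 / 2 : ℂ) • (proj ψ + proj (spinFlip ψ)) = proj a + proj b := by
  obtain ⟨c, hc, hz⟩ : ∃ c : ℂ, ‖c‖ = 1 ∧
      star c * star c * (star ψ ⬝ᵥ spinFlip ψ) = concurrence ψ := by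
    set z := star ψ ⬝ᵥ spinFlip ψ with hz
    -- The overlap picks up the square of the conjugate phase, so half the argument makes it real
    -- and nonnegative.
    refine ⟨Complex.exp ((z.arg / 2 : ℝ) * Complex.I), Complex.norm_exp_ofReal_mul_I _, ?_⟩
    rw [concurrence_eq, ← hz]
    conv_lhs => rhs; rw [← Complex.norm_mul_exp_arg_mul_I z]
    simp only [RCLike.star_def, ← Complex.exp_conj]
    rw [mul_left_comm, ← Complex.exp_add, ← Complex.exp_add]
    simp only [map_mul, Complex.conj_ofReal, Complex.conj_I]
    rw [show ((z.arg / 2 : ℝ) : ℂ) * -Complex.I + ((z.arg / 2 : ℝ) : ℂ) * -Complex.I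
      + (z.arg : ℂ) * Complex.I = 0 by push_cast; ring, Complex.exp_zero, mul_one]
  have hcc : star c * c = 1 := by
    have := Complex.conj_mul' c
    rw [hc] at this
    simpa using this
  set x := c • ψ with hx
  set y := spinFlip x with hy
  have hxx : star x ⬝ᵥ x = 1 := by
    have : star ψ ⬝ᵥ ψ = 1 := hψ
    rw [hx, star_smul, smul_dotProduct, dotProduct_smul, this, smul_eq_mul, smul_eq_mul, mul_one,
      hcc]
  have hyy : star y ⬝ᵥ y = 1 := by rw [hy, spinFlip_dotProduct_spinFlip, hxx]
  have hxy : star x ⬝ᵥ y = concurrence ψ := by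
    rw [hy, hx, spinFlip_smul, star_smul, smul_dotProduct, dotProduct_smul, ← hz, smul_eq_mul,
      smul_eq_mul, mul_assoc]
  have hyx : star y ⬝ᵥ x = concurrence ψ := by
    rw [star_dotProduct_comm, hxy]; simp
  have hpx : proj x = proj ψ := by rw [hx, proj_smul, hc]; simp
  have hpy : proj y = proj (spinFlip ψ) := by
    rw [hy, hx, spinFlip_smul, proj_smul, norm_star, hc]; simp
  clear_value x y
  -- Since `y` is the spin flip of `x`, these are the real part (x + y)/2 and the imaginary part (x
  -- - y)/(2i) of `x`. They are orthogonal because ⟨x|y⟩ is real.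
  refine ⟨(1 / 2 : ℂ) • (x + y), (-Complex.I / 2 : ℂ) • (x - y), ?_, ?_, ?_, ?_⟩
  · simp only [star_smul, star_add, smul_dotProduct, dotProduct_smul, add_dotProduct,
      dotProduct_sub, hxx, hxy, hyx, hyy, smul_eq_mul]
    ring
  · simp only [star_smul, star_add, smul_dotProduct, dotProduct_smul, add_dotProduct,
      dotProduct_add, hxx, hxy, hyx, hyy, smul_eq_mul]
    simp
    ring
  · simp only [star_smul, star_sub, smul_dotProduct, dotProduct_smul, sub_dotProduct,
      dotProduct_sub, hxx, hxy, hyx, hyy, smul_eq_mul]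
    simp
    ring_nf
    simp
    ring
  · rw [← hpx, ← hpy, proj_smul, proj_smul]
    ext i j
    simp [proj, Matrix.vecMulVec_apply]
    ring_nf

theorem concurrence_le_one {ψ : Qubits → ℂ} (hψ : IsUnitVec ψ) : concurrence ψ ≤ 1 := by
  obtain ⟨a, b, -, -, h, -⟩ := exists_real_imag_parts hψ
  have h1 : 0 ≤ star b ⬝ᵥ b := dotProduct_star_self_nonneg b
  rw [h] at h1
  have : (0 : ℝ) ≤ (1 - concurrence ψ) / 2 := by exact_mod_cast h1
  linarith

theorem trace_proj {n : Type*} [Fintype n] (ψ : n → ℂ) : (proj ψ).trace = star ψ ⬝ᵥ ψ := by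
  rw [proj, Matrix.trace_vecMulVec, dotProduct_comm]

theorem exists_eq_smul_unitVec {n : Type*} [Fintype n] [DecidableEq n] [Nonempty n]
    (φ : n → ℂ) : ∃ (r : ℝ) (ψ : n → ℂ), 0 ≤ r ∧ IsUnitVec ψ ∧ φ = (r : ℂ) • ψ := by
  by_cases h : φ = 0
  · obtain ⟨i⟩ := ‹Nonempty n›
    refine ⟨0, Pi.single i 1, le_rfl, ?_, by simp [h]⟩
    simp [IsUnitVec]
  · have h0 : 0 ≤ star φ ⬝ᵥ φ := dotProduct_star_self_nonneg φ
    have h1 : star φ ⬝ᵥ φ ≠ 0 := fun h' => h (dotProduct_star_self_eq_zero.mp h')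
    obtain ⟨s, hs⟩ : ∃ s : ℝ, star φ ⬝ᵥ φ = s :=
      ⟨_, (Complex.ext rfl (by simpa using (Complex.le_def.mp h0).2.symm))⟩
    rw [hs] at h0 h1
    have hs0 : 0 < s := lt_of_le_of_ne (by exact_mod_cast h0) (by exact_mod_cast h1.symm)
    have hr : (Real.sqrt s : ℂ) ≠ 0 := by exact_mod_cast (Real.sqrt_pos.mpr hs0).ne'
    refine ⟨Real.sqrt s, (Real.sqrt s : ℂ)⁻¹ • φ, Real.sqrt_nonneg s, ?_, ?_⟩
    · rw [IsUnitVec, star_smul, smul_dotProduct, dotProduct_smul, hs]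
      simp only [star_inv₀, RCLike.star_def, Complex.conj_ofReal, smul_eq_mul]
      field_simp
      exact_mod_cast (Real.sq_sqrt hs0.le).symm
    · rw [smul_smul, mul_inv_cancel₀ hr, one_smul]

/-- Concurrence is homogeneous of degree 2, so the weights can be absorbed into unnormalized
vectors, zero vectors included; trace one restores the normalization of the weights. -/
theorem sum_concurrence_mem_avgConcurrences {ρ : Matrix Qubits Qubits ℂ} (hρ : IsState ρ)
    {ι : Type*} [Fintype ι] (φ : ι → Qubits → ℂ) (h : ρ = ∑ i, proj (φ i)) :
    ∑ i, concurrence (φ i) ∈ avgConcurrences ρ := by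
  choose r ψ hr hψ hφ using fun i => exists_eq_smul_unitVec (φ i)
  have hp : ∀ i, proj (φ i) = ((r i ^ 2 : ℝ) : ℂ) • proj (ψ i) := by
    intro i
    rw [hφ, proj_smul, Complex.norm_real, Real.norm_eq_abs, sq_abs]
  have hs : ∑ i, r i ^ 2 = 1 := by
    have h1 := hρ.2
    rw [h, Matrix.trace_sum] at h1
    have h2 : ∀ i, (proj (φ i)).trace = ((r i ^ 2 : ℝ) : ℂ) := by
      intro i
      rw [hp, Matrix.trace_smul, trace_proj, hψ i, smul_eq_mul, mul_one]
    simp only [h2] at h1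
    exact_mod_cast h1
  let E := (Fintype.equivFin ι).symm
  refine ⟨Fintype.card ι, fun k => r (E k) ^ 2, fun k => ψ (E k),
    ⟨fun k => sq_nonneg _, ?_, fun k => hψ _, ?_⟩, ?_⟩
  · rw [E.sum_comp (fun i => r i ^ 2), hs]
  · rw [h, E.sum_comp (fun i => ((r i ^ 2 : ℝ) : ℂ) • proj (ψ i))]
    exact Finset.sum_congr rfl fun i _ => hp i
  · rw [E.sum_comp (fun i => r i ^ 2 * concurrence (ψ i))]
    refine Finset.sum_congr rfl fun i _ => ?_
    rw [hφ, concurrence_smul, Complex.norm_real, Real.norm_eq_abs, sq_abs]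

theorem nonneg_of_mem_avgConcurrences {ρ : Matrix Qubits Qubits ℂ} {x : ℝ}
    (hx : x ∈ avgConcurrences ρ) : 0 ≤ x := by
  obtain ⟨m, p, Ψ, h, rfl⟩ := hx
  exact Finset.sum_nonneg fun k _ => mul_nonneg (h.1 k) (concurrence_nonneg _)

theorem mixedConcurrence_nonneg (ρ : Matrix Qubits Qubits ℂ) : 0 ≤ mixedConcurrence ρ :=
  Real.sInf_nonneg fun _ => nonneg_of_mem_avgConcurrences

theorem mixedConcurrence_le {ρ : Matrix Qubits Qubits ℂ} {x : ℝ}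
    (hx : x ∈ avgConcurrences ρ) : mixedConcurrence ρ ≤ x :=
  csInf_le ⟨0, fun _ => nonneg_of_mem_avgConcurrences⟩ hx

theorem IsSpectral.mixedConcurrence_le {ρ : Matrix Qubits Qubits ℂ} {t : Qubits → ℝ}
    {e : Qubits → Qubits → ℂ} (h : IsSpectral ρ t e) (hρ : IsState ρ) :
    mixedConcurrence ρ ≤ ∑ i, t i * concurrence (e i) := by
  have h0 := h.nonneg hρ.1
  have hn : ∀ i, ‖(Real.sqrt (t i) : ℂ)‖ ^ 2 = t i := by
    intro i
    rw [Complex.norm_real, Real.norm_eq_abs, sq_abs, Real.sq_sqrt (h0 i)]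
  have := sum_concurrence_mem_avgConcurrences hρ (fun i => (Real.sqrt (t i) : ℂ) • e i) (by
    simp only [proj_smul, hn]
    exact h.eq)
  simp only [concurrence_smul, hn] at this
  exact PTAsym.mixedConcurrence_le this

end SpinFlip

/-! ### Skew information -/

section Skew

theorem IsSpectral.trace_sqrt_mul_ptConj_sqrt {ρ : Matrix Qubits Qubits ℂ} {t : Qubits → ℝ}
    {e : Qubits → Qubits → ℂ} (h : IsSpectral ρ t e) (hρ : ρ.PosSemidef) :
    (CFC.sqrt ρ * ptConj sigmaYY 1 (CFC.sqrt ρ)).trace.re =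
      ∑ j, ∑ i, Real.sqrt (t j) * Real.sqrt (t i) * ‖star (e i) ⬝ᵥ spinFlip (e j)‖ ^ 2 := by
  have h1 : ptConj sigmaYY 1 (CFC.sqrt ρ)
      = ∑ j, (Real.sqrt (t j) : ℂ) • proj (spinFlip (e j)) := by
    rw [h.sqrt_eq hρ, h.cfc_eq, ptConj_sigmaYY_sum]
    simp [ptConj_sigmaYY_proj]
  rw [h1, Matrix.mul_sum, Matrix.trace_sum, Complex.re_sum]
  refine Finset.sum_congr rfl fun j _ => ?_
  rw [Matrix.mul_smul, Matrix.trace_smul, trace_mul_proj, h.sqrt_eq hρ, h.cfc_quadForm, smul_eq_mul,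
    Complex.re_ofReal_mul, Complex.ofReal_re, Finset.mul_sum]
  simp only [mul_assoc]

theorem gammaS_add_sq_le {ρ : Matrix Qubits Qubits ℂ} (hρ : IsState ρ) :
    gammaS sigmaYY 1 ρ + mixedConcurrence ρ ^ 2 ≤ 1 := by
  obtain ⟨t, e, h⟩ := exists_isSpectral hρ.1.1
  have h0 := h.nonneg hρ.1
  have h1 : mixedConcurrence ρ ^ 2 ≤ (∑ i, t i * concurrence (e i)) ^ 2 :=
    pow_le_pow_left₀ (mixedConcurrence_nonneg ρ) (h.mixedConcurrence_le hρ) 2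
  -- Jensen's inequality for the square.
  have h2 : (∑ i, t i * concurrence (e i)) ^ 2 ≤ ∑ i, t i * concurrence (e i) ^ 2 := by
    have := (convexOn_pow (𝕜 := ℝ) 2).map_sum_le (t := Finset.univ) (w := t)
      (p := fun i => concurrence (e i)) (fun i _ => h0 i) (h.sum_eq_one hρ)
      (fun i _ => concurrence_nonneg (e i))
    simpa using this
  have h3 : ∑ i, t i * concurrence (e i) ^ 2
      ≤ (CFC.sqrt ρ * ptConj sigmaYY 1 (CFC.sqrt ρ)).trace.re := by
    -- All terms of the double sum are nonnegative; only the diagonal ones are kept.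
    rw [h.trace_sqrt_mul_ptConj_sqrt hρ.1]
    refine Finset.sum_le_sum fun j _ => ?_
    refine le_trans (le_of_eq ?_) (Finset.single_le_sum (f := fun i =>
      Real.sqrt (t j) * Real.sqrt (t i) * ‖star (e i) ⬝ᵥ spinFlip (e j)‖ ^ 2)
      (fun i _ => by positivity) (Finset.mem_univ j))
    simp only [Real.mul_self_sqrt (h0 j), concurrence_eq]
  unfold gammaS
  linarith

theorem proj_mul_proj {n : Type*} [Fintype n] (ψ φ : n → ℂ) :
    proj ψ * proj φ = (star ψ ⬝ᵥ φ) • Matrix.vecMulVec ψ (star φ) := by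
  rw [proj, proj, Matrix.vecMulVec_mul_vecMulVec]
  ext i j
  simp [Matrix.vecMulVec_apply, mul_left_comm]

theorem IsUnitVec.isState_proj {n : Type*} [Fintype n] {ψ : n → ℂ} (h : IsUnitVec ψ) :
    IsState (proj ψ) :=
  ⟨proj_posSemidef ψ, by rw [trace_proj, h]⟩

theorem IsUnitVec.sqrt_proj {n : Type*} [Fintype n] [DecidableEq n] {ψ : n → ℂ}
    (h : IsUnitVec ψ) : CFC.sqrt (proj ψ) = proj ψ := by
  refine sqrt_eq_of_mul_self (proj_posSemidef ψ) ?_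
  have h' : star ψ ⬝ᵥ ψ = 1 := h
  rw [proj_mul_proj, h', one_smul, proj]

theorem gammaS_proj {ψ : Qubits → ℂ} (h : IsUnitVec ψ) :
    gammaS sigmaYY 1 (proj ψ) + concurrence ψ ^ 2 = 1 := by
  rw [gammaS, h.sqrt_proj, ptConj_sigmaYY_proj, trace_mul_proj, proj_mulVec, dotProduct_smul,
    smul_eq_mul, conj_mul_dotProduct, Complex.ofReal_re, concurrence_eq, star_dotProduct_comm,
    norm_star]
  ring

end Skew


/-! ### Relative entropy: Klein's inequality, the optimal symmetric state, the entropy bound -/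

section RelativeEntropy

/-- This is ln x ≤ x - 1 at x = s/t, multiplied by t. Both operator inequalities below are averages
of it. -/
theorem mul_logb_sub_le {t s : ℝ} (ht : 0 ≤ t) (hs : 0 < s) :
    t * Real.logb 2 s - t * Real.logb 2 t ≤ (s - t) / Real.log 2 := by
  have h2 : 0 < Real.log 2 := Real.log_pos one_lt_two
  rcases ht.eq_or_lt with rfl | ht
  · simp only [zero_mul, sub_zero]
    positivity
  · have h := Real.log_le_sub_one_of_pos (div_pos hs ht)
    rw [Real.log_div hs.ne' ht.ne'] at h
    have h' := mul_le_mul_of_nonneg_left h ht.le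
    rw [mul_sub, mul_sub, mul_div_cancel₀ _ ht.ne', mul_one] at h'
    simp only [Real.logb, ← mul_div_assoc, ← sub_div]
    exact div_le_div_of_nonneg_right h' h2.le

theorem mul_logb_mul (t a : ℝ) :
    t * a * Real.logb 2 (t * a) = a * (t * Real.logb 2 t) + t * (a * Real.logb 2 a) := by
  by_cases ht : t = 0
  · simp [ht]
  by_cases ha : a = 0
  · simp [ha]
  rw [Real.logb_mul ht ha]
  ring

theorem binH_eq (p : ℝ) : binH p = Real.binEntropy p / Real.log 2 := by
  rw [binH, Real.binEntropy_eq_negMulLog_add_negMulLog_one_sub, Real.negMulLog, Real.negMulLog]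
  simp only [Real.logb]
  ring

theorem concaveOn_binH : ConcaveOn ℝ (Set.Icc 0 1) binH := by
  have h := Real.strictConcave_binEntropy.concaveOn.smul
    (inv_nonneg.mpr (Real.log_pos one_lt_two).le)
  have e : binH = fun p => (Real.log 2)⁻¹ • Real.binEntropy p := by
    funext p
    rw [binH_eq, smul_eq_mul, div_eq_inv_mul]
  rw [e]
  exact h

theorem binH_mono {p q : ℝ} (hp : 0 ≤ p) (hpq : p ≤ q) (hq : q ≤ 1 / 2) : binH p ≤ binH q := by
  rw [binH_eq, binH_eq]
  refine div_le_div_of_nonneg_right ?_ (Real.log_pos one_lt_two).le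
  rw [one_div] at hq
  exact Real.binEntropy_strictMonoOn.monotoneOn ⟨hp, hpq.trans hq⟩ ⟨hp.trans hpq, hq⟩ hpq

variable {n : Type*} [Fintype n] [DecidableEq n]

theorem IsSpectral.trace_mul_log2 {A : Matrix n n ℂ} {t : n → ℝ} {e : n → n → ℂ}
    (h : IsSpectral A t e) : (A * log2 A).trace.re = ∑ i, t i * Real.logb 2 (t i) := by
  rw [log2, h.trace_mul_cfc, Complex.re_sum]
  refine Finset.sum_congr rfl fun i _ => ?_
  rw [h.mulVec_eigenvector, dotProduct_smul, h.isUnitVec i, smul_eq_mul, mul_one,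
    Complex.re_ofReal_mul, Complex.ofReal_re, mul_comm]

theorem norm_star_dotProduct_comm {n : Type*} [Fintype n] (v w : n → ℂ) :
    ‖star v ⬝ᵥ w‖ = ‖star w ⬝ᵥ v‖ := by
  rw [star_dotProduct_comm, norm_star]

theorem IsSpectral.sum_norm_sq_of_isUnitVec {A : Matrix n n ℂ} {t : n → ℝ} {e : n → n → ℂ}
    (h : IsSpectral A t e) {v : n → ℂ} (hv : IsUnitVec v) :
    ∑ i, ‖star (e i) ⬝ᵥ v‖ ^ 2 = 1 := by
  have := h.sum_norm_sq v
  rw [hv] at this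
  exact_mod_cast this.symm

/-- **Klein's inequality**. -/
theorem trace_mul_log2_le {τ σ : Matrix n n ℂ} (hτ : IsState τ) (hσ : IsState σ)
    (hker : ∀ v : n → ℂ, σ.mulVec v = 0 → τ.mulVec v = 0) :
    (τ * log2 σ).trace.re ≤ (τ * log2 τ).trace.re := by
  obtain ⟨t, e, hte⟩ := exists_isSpectral hτ.1.1
  obtain ⟨s, f, hsf⟩ := exists_isSpectral hσ.1.1
  have ht := hte.nonneg hτ.1
  have hs := hsf.nonneg hσ.1
  have h2 : 0 < Real.log 2 := Real.log_pos one_lt_two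
  -- The squared overlaps of the two eigenbases form a doubly stochastic matrix, which reduces the
  -- claim to the scalar inequality.
  set w : n → n → ℝ := fun i j => ‖star (e i) ⬝ᵥ f j‖ ^ 2 with hw
  have hw0 : ∀ i j, 0 ≤ w i j := fun i j => sq_nonneg _
  have hw1 : ∀ j, ∑ i, w i j = 1 := fun j => hte.sum_norm_sq_of_isUnitVec (hsf.isUnitVec j)
  have hw2 : ∀ i, ∑ j, w i j = 1 := by
    intro i
    simp only [hw, norm_star_dotProduct_comm (e i)]
    exact hsf.sum_norm_sq_of_isUnitVec (hte.isUnitVec i)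
  have hL : (τ * log2 σ).trace.re = ∑ i, ∑ j, w i j * (t i * Real.logb 2 (s j)) := by
    rw [log2, hsf.trace_mul_cfc, Complex.re_sum, Finset.sum_comm]
    refine Finset.sum_congr rfl fun j _ => ?_
    rw [hte.quadForm, Complex.re_ofReal_mul, Complex.ofReal_re, Finset.mul_sum]
    exact Finset.sum_congr rfl fun i _ => by ring
  have hR : (τ * log2 τ).trace.re = ∑ i, ∑ j, w i j * (t i * Real.logb 2 (t i)) := by
    rw [hte.trace_mul_log2]
    refine Finset.sum_congr rfl fun i _ => ?_
    rw [← Finset.sum_mul, hw2, one_mul]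
  have hker' : ∀ i j, s j = 0 → w i j * t i = 0 := by
    intro i j hj
    have h0 : τ.mulVec (f j) = 0 := by
      apply hker
      rw [hsf.mulVec_eigenvector, hj]
      simp
    have h1 := hte.quadForm (f j)
    rw [h0, dotProduct_zero] at h1
    have h3 : ∑ i, t i * ‖star (e i) ⬝ᵥ f j‖ ^ 2 = 0 := by exact_mod_cast h1.symm
    have := (Finset.sum_eq_zero_iff_of_nonneg fun i _ => mul_nonneg (ht i) (hw0 i j)).mp h3 i
      (Finset.mem_univ i)
    rw [mul_comm]
    exact this
  have hterm : ∀ i j, w i j * (t i * Real.logb 2 (s j)) - w i j * (t i * Real.logb 2 (t i))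
      ≤ w i j * ((s j - t i) / Real.log 2) := by
    intro i j
    rcases (hs j).eq_or_lt with h0 | h0
    · have := hker' i j h0.symm
      rw [← h0]
      have e1 : w i j * ((0 - t i) / Real.log 2) = -(w i j * t i) / Real.log 2 := by ring
      rw [e1, ← mul_assoc, ← mul_assoc, this]
      simp
    · rw [← mul_sub]
      exact mul_le_mul_of_nonneg_left (mul_logb_sub_le (ht i) h0) (hw0 i j)
  have hsum : ∑ i, ∑ j, w i j * ((s j - t i) / Real.log 2) = 0 := by
    have e1 : ∀ i j, w i j * ((s j - t i) / Real.log 2)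
        = (w i j * s j - w i j * t i) / Real.log 2 := fun i j => by ring
    simp only [e1, ← Finset.sum_div, Finset.sum_sub_distrib]
    rw [Finset.sum_comm]
    simp only [← Finset.sum_mul, hw1, hw2, one_mul, hsf.sum_eq_one hσ, hte.sum_eq_one hτ, sub_self,
      zero_div]
  have := Finset.sum_le_sum fun i (_ : i ∈ Finset.univ) =>
    Finset.sum_le_sum fun j (_ : j ∈ Finset.univ) => hterm i j
  simp only [Finset.sum_sub_distrib, hsum] at this
  rw [hL, hR]
  linarith

theorem IsSpectral.dotProduct_cfc_mulVec {A : Matrix n n ℂ} {t : n → ℝ} {e : n → n → ℂ}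
    (h : IsSpectral A t e) (f : ℝ → ℝ) (i : n) (v : n → ℂ) :
    star (e i) ⬝ᵥ (cfc f A).mulVec v = (f (t i) : ℂ) * (star (e i) ⬝ᵥ v) := by
  rw [h.cfc_eq, sum_smul_proj_mulVec, dotProduct_sum, Finset.sum_eq_single i]
  · simp [h.orth]
  · intro j _ hj
    simp [h.orth, hj.symm]
  · simp

/-- If `|φ⟩⟨φ| ≤ τ`, then `⟨φ|log τ|φ⟩` is at least what it is for `τ = |φ⟩⟨φ|`. -/
theorem mul_logb_le_dotProduct_log2 {τ : Matrix n n ℂ} (hτ : τ.PosSemidef) {φ : n → ℂ} {q : ℝ}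
    (hq : star φ ⬝ᵥ φ = q) (h : (τ - proj φ).PosSemidef) :
    q * Real.logb 2 q ≤ (star φ ⬝ᵥ (log2 τ).mulVec φ).re := by
  obtain ⟨s, f, hsf⟩ := exists_isSpectral hτ.1
  have hs := hsf.nonneg hτ
  have h2 : 0 < Real.log 2 := Real.log_pos one_lt_two
  set x : n → ℝ := fun l => ‖star (f l) ⬝ᵥ φ‖ ^ 2 with hx
  have hx0 : ∀ l, 0 ≤ x l := fun l => sq_nonneg _
  have hqx : q = ∑ l, x l := by
    have := hsf.sum_norm_sq φ
    rw [hq] at this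
    exact_mod_cast this
  have hform : ∀ v : n → ℂ, ‖star φ ⬝ᵥ v‖ ^ 2 ≤ ∑ l, s l * ‖star (f l) ⬝ᵥ v‖ ^ 2 := by
    intro v
    have h1 := h.dotProduct_mulVec_nonneg v
    rw [Matrix.sub_mulVec, dotProduct_sub, hsf.quadForm, proj_mulVec, dotProduct_smul, smul_eq_mul,
      conj_mul_dotProduct, norm_star_dotProduct_comm, ← Complex.ofReal_sub] at h1
    have h3 := Complex.zero_le_real.mp h1
    linarith
  have hxs : ∀ l, x l ≤ s l := by
    intro l
    have h1 := hform (f l)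
    rw [norm_star_dotProduct_comm] at h1
    simpa [hsf.orth, apply_ite norm, ite_pow] using h1
  -- z = ⟨φ|τ⁻¹|φ⟩ with the pseudo-inverse (0⁻¹ = 0). Testing |φ⟩⟨φ| ≤ τ on τ⁻¹φ gives z² ≤ z, hence
  -- z ≤ 1.
  set z : ℝ := ∑ l, (s l)⁻¹ * x l with hz
  have hz0 : 0 ≤ z := Finset.sum_nonneg fun l _ => mul_nonneg (inv_nonneg.mpr (hs l)) (hx0 l)
  have hz1 : z ≤ 1 := by
    have h1 := hform ((cfc (fun r : ℝ => r⁻¹) τ).mulVec φ)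
    rw [hsf.cfc_quadForm, Complex.norm_real, Real.norm_eq_abs, sq_abs] at h1
    have h3 : ∑ l, s l * ‖star (f l) ⬝ᵥ (cfc (fun r : ℝ => r⁻¹) τ).mulVec φ‖ ^ 2 = z := by
      refine Finset.sum_congr rfl fun l _ => ?_
      rw [hsf.dotProduct_cfc_mulVec, norm_mul, Complex.norm_real, Real.norm_eq_abs, mul_pow, sq_abs]
      rcases (hs l).eq_or_lt with h0 | h0
      · simp [← h0]
      · field_simp
        rfl
    rw [h3] at h1
    change z ^ 2 ≤ z at h1
    nlinarith
  have hgoal : (star φ ⬝ᵥ (log2 τ).mulVec φ).re = ∑ l, x l * Real.logb 2 (s l) := by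
    rw [log2, hsf.cfc_quadForm, Complex.ofReal_re]
    exact Finset.sum_congr rfl fun l _ => mul_comm _ _
  have hq0 : 0 ≤ q := hqx ▸ Finset.sum_nonneg fun l _ => hx0 l
  rcases hq0.eq_or_lt with h0 | h0
  · have h1 : ∀ l, x l = 0 := fun l =>
      (Finset.sum_eq_zero_iff_of_nonneg fun l _ => hx0 l).mp (hqx.symm.trans h0.symm) l
        (Finset.mem_univ l)
    rw [hgoal, ← h0]
    simp [h1]
  -- The scalar inequality for the pair `s l`, `q`, weighted by `x l / s l`; summed over l, its
  -- right side is q(z - 1)/ln 2 ≤ 0.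
  · have hterm : ∀ l, x l * Real.logb 2 q - x l * Real.logb 2 (s l)
        ≤ (q * ((s l)⁻¹ * x l) - x l) / Real.log 2 := by
      intro l
      rcases (hs l).eq_or_lt with hl | hl
      · have : x l = 0 := le_antisymm (hl ▸ hxs l) (hx0 l)
        simp [this]
      · have h1 := mul_le_mul_of_nonneg_left (mul_logb_sub_le hl.le h0)
          (mul_nonneg (inv_nonneg.mpr (hs l)) (hx0 l))
        have e1 : (s l)⁻¹ * x l * (s l * Real.logb 2 q - s l * Real.logb 2 (s l))
            = x l * Real.logb 2 q - x l * Real.logb 2 (s l) := by field_simp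
        have e2 : (s l)⁻¹ * x l * ((q - s l) / Real.log 2)
            = (q * ((s l)⁻¹ * x l) - x l) / Real.log 2 := by field_simp
        rwa [e1, e2] at h1
    have h1 := Finset.sum_le_sum fun l (_ : l ∈ Finset.univ) => hterm l
    rw [Finset.sum_sub_distrib, ← Finset.sum_mul, ← hqx, ← Finset.sum_div, Finset.sum_sub_distrib,
      ← Finset.mul_sum, ← hqx, ← hgoal, ← hz] at h1
    have h3 : (q * z - q) / Real.log 2 ≤ 0 :=
      div_nonpos_of_nonpos_of_nonneg (by nlinarith) h2.le
    linarith

/-- An invariant σ commutes with the spin flip and has real eigenvalues, so the spin flip preserves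
its eigenspaces; values of `f` are real and pass through the conjugation. -/
theorem ptConj_sigmaYY_cfc {σ : Matrix Qubits Qubits ℂ} (hσ : σ.IsHermitian)
    (h : ptConj sigmaYY 1 σ = σ) (f : ℝ → ℝ) : ptConj sigmaYY 1 (cfc f σ) = cfc f σ := by
  obtain ⟨s, e, hs⟩ := exists_isSpectral hσ
  refine hs.ext_mulVec fun i => ?_
  have h1 : σ.mulVec (spinFlip (e i)) = (s i : ℂ) • spinFlip (e i) := by
    have h2 : spinFlip (σ.mulVec (spinFlip (e i))) = (s i : ℂ) • e i := by
      rw [← ptConj_sigmaYY_mulVec, h, hs.mulVec_eigenvector]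
    rw [← spinFlip_spinFlip (σ.mulVec (spinFlip (e i))), h2, spinFlip_smul]
    simp
  rw [ptConj_sigmaYY_mulVec, cfc_mulVec_of_eigenvector hσ h1, spinFlip_smul, spinFlip_spinFlip,
    hs.cfc_mulVec_eigenvector]
  simp

/-- The average of a state and its image under `PT`. -/
noncomputable def symPart (ρ : Matrix Qubits Qubits ℂ) : Matrix Qubits Qubits ℂ :=
  ((1 / 2 : ℝ) : ℂ) • (ρ + ptConj sigmaYY 1 ρ)

theorem symPart_mem_symStates {ρ : Matrix Qubits Qubits ℂ} (hρ : IsState ρ) :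
    symPart ρ ∈ symStates sigmaYY 1 := by
  refine ⟨⟨?_, ?_⟩, ?_⟩
  · exact (hρ.1.add (ptConj_sigmaYY_posSemidef hρ.1)).smul
      (Complex.zero_le_real.mpr (by norm_num))
  · rw [symPart, Matrix.trace_smul, Matrix.trace_add, trace_ptConj_sigmaYY, hρ.2]
    norm_num
  · rw [symPart, ptConj_sigmaYY_smul, ptConj_sigmaYY_add, ptConj_sigmaYY_ptConj, add_comm]

/-- By invariance of `G`, Tr(θρθ G) = Tr(θ(ρG)θ), the conjugate of Tr(ρG); the real parts agree. -/
theorem trace_symPart_mul {ρ G : Matrix Qubits Qubits ℂ} (hG : ptConj sigmaYY 1 G = G) :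
    (symPart ρ * G).trace.re = (ρ * G).trace.re := by
  have h : (ptConj sigmaYY 1 ρ * G).trace = star (ρ * G).trace := by
    conv_lhs => rw [← hG]
    rw [← ptConj_sigmaYY_mul, trace_ptConj_sigmaYY]
  rw [symPart, Matrix.smul_mul, Matrix.trace_smul, Matrix.add_mul, Matrix.trace_add, h, smul_eq_mul,
    Complex.re_ofReal_mul, Complex.add_re, RCLike.star_def, Complex.conj_re]
  ring

theorem mulVec_eq_zero_of_symPart {ρ : Matrix Qubits Qubits ℂ} (hρ : ρ.PosSemidef)
    {v : Qubits → ℂ} (hv : (symPart ρ).mulVec v = 0) : ρ.mulVec v = 0 := by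
  have h1 := hρ.dotProduct_mulVec_nonneg v
  have h2 := (ptConj_sigmaYY_posSemidef hρ).dotProduct_mulVec_nonneg v
  have h3 : star v ⬝ᵥ ρ.mulVec v + star v ⬝ᵥ (ptConj sigmaYY 1 ρ).mulVec v = 0 := by
    rw [symPart, Matrix.smul_mulVec, Matrix.add_mulVec, smul_eq_zero] at hv
    rw [← dotProduct_add, hv.resolve_left (by norm_num), dotProduct_zero]
  exact (hρ.dotProduct_mulVec_zero_iff v).mp ((add_eq_zero_iff_of_nonneg h1 h2).mp h3).1

theorem symPart_mulVec_eq_zero {ρ σ : Matrix Qubits Qubits ℂ} (hσ : ptConj sigmaYY 1 σ = σ)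
    (hker : ∀ v : Qubits → ℂ, σ.mulVec v = 0 → ρ.mulVec v = 0) {v : Qubits → ℂ}
    (hv : σ.mulVec v = 0) : (symPart ρ).mulVec v = 0 := by
  have h0 : spinFlip (0 : Qubits → ℂ) = 0 := by simp [spinFlip]
  have h1 : σ.mulVec (spinFlip v) = 0 := by
    rw [← spinFlip_spinFlip (σ.mulVec (spinFlip v)), ← ptConj_sigmaYY_mulVec, hσ, hv, h0]
  rw [symPart, Matrix.smul_mulVec, Matrix.add_mulVec, hker v hv, ptConj_sigmaYY_mulVec,
    hker _ h1, h0, add_zero, smul_zero]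

theorem relEntropy_symPart {ρ : Matrix Qubits Qubits ℂ} (hρ : IsState ρ) :
    relEntropy ρ (symPart ρ) =
      (((ρ * log2 ρ).trace.re - (symPart ρ * log2 (symPart ρ)).trace.re : ℝ) : EReal) := by
  have hτ := symPart_mem_symStates hρ
  rw [relEntropy, if_pos fun v hv => mulVec_eq_zero_of_symPart hρ.1 hv, trace_symPart_mul]
  exact ptConj_sigmaYY_cfc hτ.1.1.1 hτ.2 _

/-- Both logarithms are invariant, so ρ can be replaced by its symmetric part in the cross terms;
the difference is then Klein's inequality. -/
theorem relEntropy_symPart_le {ρ σ : Matrix Qubits Qubits ℂ} (hρ : IsState ρ)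
    (hσ : σ ∈ symStates sigmaYY 1) : relEntropy ρ (symPart ρ) ≤ relEntropy ρ σ := by
  rw [relEntropy_symPart hρ, relEntropy]
  split_ifs with hker
  · have hG : ptConj sigmaYY 1 (log2 σ) = log2 σ := ptConj_sigmaYY_cfc hσ.1.1.1 hσ.2 _
    rw [← trace_symPart_mul (ρ := ρ) hG]
    have := trace_mul_log2_le (symPart_mem_symStates hρ).1 hσ.1
      fun v hv => symPart_mulVec_eq_zero hσ.2 hker hv
    exact EReal.coe_le_coe_iff.mpr (by linarith)
  · exact le_top

theorem relEntropy_symPart_eq_gammaR {ρ : Matrix Qubits Qubits ℂ} (hρ : IsState ρ) :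
    relEntropy ρ (symPart ρ) = gammaR sigmaYY 1 ρ :=
  le_antisymm (le_iInf₂ fun _ hσ => relEntropy_symPart_le hρ hσ)
    (iInf₂_le (symPart ρ) (symPart_mem_symStates hρ))

theorem symPart_proj {ψ a b : Qubits → ℂ}
    (h : (1 / 2 : ℂ) • (proj ψ + proj (spinFlip ψ)) = proj a + proj b) :
    symPart (proj ψ) = proj a + proj b := by
  rw [symPart, ptConj_sigmaYY_proj, ← h]
  push_cast
  rfl

theorem trace_proj_add_proj_mul (a b : Qubits → ℂ) (G : Matrix Qubits Qubits ℂ) :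
    ((proj a + proj b) * G).trace.re = (star a ⬝ᵥ G.mulVec a).re + (star b ⬝ᵥ G.mulVec b).re := by
  rw [Matrix.add_mul, Matrix.trace_add, Matrix.trace_mul_comm, trace_mul_proj,
    Matrix.trace_mul_comm, trace_mul_proj, Complex.add_re]

/-- The vectors a, b are orthogonal, hence eigenvectors of the symmetric part |a⟩⟨a| + |b⟩⟨b| whose
eigenvalues are their squared norms. The case b = 0 needs no separate treatment. -/
theorem gammaR_proj {ψ : Qubits → ℂ} (hψ : IsUnitVec ψ) :
    gammaR sigmaYY 1 (proj ψ) = ((binH (1 / 2 - 1 / 2 * concurrence ψ) : ℝ) : EReal) := by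
  have hρ := hψ.isState_proj
  obtain ⟨a, b, hab, ha, hb, h⟩ := exists_real_imag_parts hψ
  have hba : star b ⬝ᵥ a = 0 := by rw [star_dotProduct_comm, hab, star_zero]
  have hτ := symPart_proj h
  have hτH : (proj a + proj b).IsHermitian := ((proj_posSemidef a).add (proj_posSemidef b)).1
  have e1 : (proj ψ * log2 (proj ψ)).trace.re = 0 := by
    rw [Matrix.trace_mul_comm, trace_mul_proj, log2,
      cfc_mulVec_of_eigenvector (μ := 1) hρ.1.1 (by rw [proj_mulVec, hψ, Complex.ofReal_one])]
    simp
  have e2 : (star a ⬝ᵥ (log2 (proj a + proj b)).mulVec a).re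
      = (1 + concurrence ψ) / 2 * Real.logb 2 ((1 + concurrence ψ) / 2) := by
    rw [log2, cfc_mulVec_of_eigenvector (μ := (1 + concurrence ψ) / 2) hτH (by
      rw [Matrix.add_mulVec, proj_mulVec, proj_mulVec, ha, hba, zero_smul, add_zero])]
    rw [dotProduct_smul, ha, smul_eq_mul, Complex.re_ofReal_mul, Complex.ofReal_re, mul_comm]
  have e3 : (star b ⬝ᵥ (log2 (proj a + proj b)).mulVec b).re
      = (1 - concurrence ψ) / 2 * Real.logb 2 ((1 - concurrence ψ) / 2) := by
    rw [log2, cfc_mulVec_of_eigenvector (μ := (1 - concurrence ψ) / 2) hτH (by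
      rw [Matrix.add_mulVec, proj_mulVec, proj_mulVec, hb, hab, zero_smul, zero_add])]
    rw [dotProduct_smul, hb, smul_eq_mul, Complex.re_ofReal_mul, Complex.ofReal_re, mul_comm]
  rw [← relEntropy_symPart_eq_gammaR hρ, relEntropy_symPart hρ, hτ, trace_proj_add_proj_mul, e1, e2,
    e3, binH]
  congr 1
  rw [show (1 : ℝ) - (1 / 2 - 1 / 2 * concurrence ψ) = (1 + concurrence ψ) / 2 by ring,
    show (1 / 2 : ℝ) - 1 / 2 * concurrence ψ = (1 - concurrence ψ) / 2 by ring]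
  ring

theorem gammaR_le {ρ : Matrix Qubits Qubits ℂ} (hρ : IsState ρ) :
    gammaR sigmaYY 1 ρ ≤ ((binH (1 / 2 - 1 / 2 * mixedConcurrence ρ) : ℝ) : EReal) := by
  obtain ⟨t, e, h⟩ := exists_isSpectral hρ.1.1
  have ht := h.nonneg hρ.1
  have hc1 := fun i => concurrence_le_one (h.isUnitVec i)
  choose a b hab ha hb hs using fun i => exists_real_imag_parts (h.isUnitVec i)
  rw [← relEntropy_symPart_eq_gammaR hρ, relEntropy_symPart hρ]
  refine EReal.coe_le_coe_iff.mpr ?_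
  have hτ : symPart ρ = ∑ i, (t i : ℂ) • (proj (a i) + proj (b i)) := by
    simp only [← hs]
    rw [symPart]
    conv_lhs => rw [h.eq]
    rw [ptConj_sigmaYY_sum, ← Finset.sum_add_distrib, Finset.smul_sum]
    refine Finset.sum_congr rfl fun i _ => ?_
    rw [ptConj_sigmaYY_proj, ← smul_add, smul_comm]
    push_cast
    rfl
  have hpsd : ∀ i, ((t i : ℂ) • (proj (a i) + proj (b i))).PosSemidef := fun i =>
    ((proj_posSemidef _).add (proj_posSemidef _)).smul (Complex.zero_le_real.mpr (ht i))
  have hge : ∀ i, (symPart ρ - (t i : ℂ) • (proj (a i) + proj (b i))).PosSemidef := by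
    intro i
    rw [hτ, ← Finset.sum_erase_add _ _ (Finset.mem_univ i), add_sub_cancel_right]
    exact Matrix.posSemidef_sum _ fun j _ => hpsd j
  have hsq : ∀ i, ‖(Real.sqrt (t i) : ℂ)‖ ^ 2 = t i := by
    intro i
    rw [Complex.norm_real, Real.norm_eq_abs, sq_abs, Real.sq_sqrt (ht i)]
  -- The logarithm bound, applied to √(t_i) v.
  have hvec : ∀ i (v : Qubits → ℂ) (α : ℝ), star v ⬝ᵥ v = α →
      (symPart ρ - (t i : ℂ) • proj v).PosSemidef →
      t i * α * Real.logb 2 (t i * α) ≤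
        t i * (star v ⬝ᵥ (log2 (symPart ρ)).mulVec v).re := by
    intro i v α hv hp
    have hss : (Real.sqrt (t i) : ℂ) * Real.sqrt (t i) = t i := by
      exact_mod_cast Real.mul_self_sqrt (ht i)
    have h1 := mul_logb_le_dotProduct_log2 (symPart_mem_symStates hρ).1.1
      (φ := (Real.sqrt (t i) : ℂ) • v) (q := t i * α) (by
        rw [star_smul, smul_dotProduct, dotProduct_smul, hv, smul_eq_mul, smul_eq_mul, ← mul_assoc,
          RCLike.star_def, Complex.conj_ofReal, hss, Complex.ofReal_mul]) (by
        rw [proj_smul, hsq]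
        exact hp)
    rwa [star_smul, smul_dotProduct, Matrix.mulVec_smul, dotProduct_smul, smul_eq_mul, smul_eq_mul,
      ← mul_assoc, RCLike.star_def, Complex.conj_ofReal, hss, Complex.re_ofReal_mul] at h1
  have hva : ∀ i, t i * ((1 + concurrence (e i)) / 2)
        * Real.logb 2 (t i * ((1 + concurrence (e i)) / 2)) ≤
      t i * (star (a i) ⬝ᵥ (log2 (symPart ρ)).mulVec (a i)).re := fun i =>
    hvec i (a i) _ (ha i) (by
      have := (hge i).add ((proj_posSemidef (b i)).smul (Complex.zero_le_real.mpr (ht i)))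
      convert this using 1
      rw [smul_add]; abel)
  have hvb : ∀ i, t i * ((1 - concurrence (e i)) / 2)
        * Real.logb 2 (t i * ((1 - concurrence (e i)) / 2)) ≤
      t i * (star (b i) ⬝ᵥ (log2 (symPart ρ)).mulVec (b i)).re := fun i =>
    hvec i (b i) _ (hb i) (by
      have := (hge i).add ((proj_posSemidef (a i)).smul (Complex.zero_le_real.mpr (ht i)))
      convert this using 1
      rw [smul_add]; abel)
  have htr : (symPart ρ * log2 (symPart ρ)).trace.re =
      ∑ i, (t i * (star (a i) ⬝ᵥ (log2 (symPart ρ)).mulVec (a i)).re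
        + t i * (star (b i) ⬝ᵥ (log2 (symPart ρ)).mulVec (b i)).re) := by
    generalize log2 (symPart ρ) = G
    rw [hτ, Matrix.sum_mul, Matrix.trace_sum, Complex.re_sum]
    refine Finset.sum_congr rfl fun i _ => ?_
    rw [Matrix.smul_mul, Matrix.trace_smul, smul_eq_mul, Complex.re_ofReal_mul,
      trace_proj_add_proj_mul, mul_add]
  -- The chain rule of Shannon entropy: splitting the weight t_i in the ratio (1 + C) : (1 - C) adds
  -- t_i H.
  have hH : ∀ i, t i * Real.logb 2 (t i)
      - t i * ((1 + concurrence (e i)) / 2) * Real.logb 2 (t i * ((1 + concurrence (e i)) / 2))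
      - t i * ((1 - concurrence (e i)) / 2) * Real.logb 2 (t i * ((1 - concurrence (e i)) / 2))
      = t i * binH (1 / 2 - 1 / 2 * concurrence (e i)) := by
    intro i
    rw [mul_logb_mul, mul_logb_mul, binH,
      show (1 : ℝ) - (1 / 2 - 1 / 2 * concurrence (e i)) = (1 + concurrence (e i)) / 2 by ring,
      show (1 / 2 : ℝ) - 1 / 2 * concurrence (e i) = (1 - concurrence (e i)) / 2 by ring]
    ring
  have hstep : (ρ * log2 ρ).trace.re - (symPart ρ * log2 (symPart ρ)).trace.re
      ≤ ∑ i, t i * binH (1 / 2 - 1 / 2 * concurrence (e i)) := by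
    rw [h.trace_mul_log2, htr, ← Finset.sum_sub_distrib]
    refine Finset.sum_le_sum fun i _ => ?_
    linarith [hva i, hvb i, hH i]
  have hJ : ∑ i, t i * binH (1 / 2 - 1 / 2 * concurrence (e i))
      ≤ binH (∑ i, t i * (1 / 2 - 1 / 2 * concurrence (e i))) := by
    have := concaveOn_binH.le_map_sum (t := Finset.univ) (w := t)
      (p := fun i => 1 / 2 - 1 / 2 * concurrence (e i)) (fun i _ => ht i) (h.sum_eq_one hρ)
      (fun i _ => ⟨by linarith [hc1 i], by linarith [concurrence_nonneg (e i)]⟩)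
    simpa only [smul_eq_mul] using this
  have hsum : ∑ i, t i * (1 / 2 - 1 / 2 * concurrence (e i))
      = 1 / 2 - 1 / 2 * ∑ i, t i * concurrence (e i) := by
    rw [Finset.mul_sum]
    simp only [mul_sub, Finset.sum_sub_distrib, ← Finset.sum_mul, h.sum_eq_one hρ, one_mul]
    congr 1
    exact Finset.sum_congr rfl fun i _ => by ring
  have hC1 : ∑ i, t i * concurrence (e i) ≤ 1 := by
    rw [← h.sum_eq_one hρ]
    exact Finset.sum_le_sum fun i _ => mul_le_of_le_one_right (ht i) (hc1 i)
  refine hstep.trans (hJ.trans ?_)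
  rw [hsum]
  exact binH_mono (by linarith) (by linarith [h.mixedConcurrence_le hρ])
    (by linarith [mixedConcurrence_nonneg ρ])

end RelativeEntropy


/-! ### Takagi factorization and the concurrence of assistance -/

section Assistance

variable {n : Type*} [Fintype n] [DecidableEq n]

theorem star_mulVec_eq_map_star {n : Type*} [Fintype n] (B : Matrix n n ℂ) (w : n → ℂ) :
    star (B.mulVec w) = (B.map star).mulVec (star w) := by
  ext i
  simp [Matrix.mulVec, dotProduct]

/-- A real form of the Takagi factorization: the real-linear symmetric operator `v ↦ star (M v)` of a
complex symmetric matrix `M` has a real orthonormal basis of eigenvectors. -/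
theorem exists_coneigenvectors {M : Matrix n n ℂ} (hM : M.transpose = M) :
    ∃ (N : ℕ) (u : Fin N → n → ℂ) (μ : Fin N → ℝ), (∀ i, IsUnitVec (u i)) ∧
      ∑ i, proj (u i) = (2 : ℂ) • (1 : Matrix n n ℂ) ∧
      ∀ i, M.mulVec (u i) = (μ i : ℂ) • star (u i) := by
  let T : EuclideanSpace ℂ n →ₗ[ℝ] EuclideanSpace ℂ n :=
    { toFun := fun x => WithLp.toLp 2 (star (M.mulVec x.ofLp))
      map_add' := fun x y => by
        ext i; simp [Matrix.mulVec_add]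
      map_smul' := fun c x => by
        ext i; simp [Matrix.mulVec_smul] }
  -- ℂⁿ is treated as a real Euclidean space with inner product Re⟨x|y⟩; for it, symmetry of `M`
  -- makes `T` self-adjoint.
  have hinner : ∀ x y : EuclideanSpace ℂ n, inner ℝ x y = (star x.ofLp ⬝ᵥ y.ofLp).re := by
    intro x y
    simp [PiLp.inner_apply, dotProduct, Complex.inner, mul_comm]
  have hT : T.IsSymmetric := by
    intro x y
    rw [hinner, hinner]
    change (star (star (M.mulVec x.ofLp)) ⬝ᵥ y.ofLp).re
      = (star x.ofLp ⬝ᵥ star (M.mulVec y.ofLp)).re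
    rw [star_star, Matrix.star_dotProduct_star, RCLike.star_def, Complex.conj_re,
      dotProduct_comm (M.mulVec y.ofLp), Matrix.dotProduct_mulVec, ← Matrix.mulVec_transpose, hM]
  set b := hT.eigenvectorBasis rfl with hb
  have hre : ∀ x : n → ℂ, ∑ i, (((star (b i).ofLp ⬝ᵥ x).re : ℝ) : ℂ) • (b i).ofLp = x := by
    intro x
    have h1 := congrArg (fun z : EuclideanSpace ℂ n => z.ofLp) (b.sum_repr' (WithLp.toLp 2 x))
    simp only [hinner, WithLp.ofLp_sum, WithLp.ofLp_smul] at h1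
    exact h1
  refine ⟨_, fun i => (b i).ofLp, hT.eigenvalues rfl, ?_, ?_, ?_⟩
  · intro i
    have h1 : inner ℝ (b i) (b i) = (1 : ℝ) := by
      rw [real_inner_self_eq_norm_sq, b.norm_eq_one, one_pow]
    rw [hinner] at h1
    have h0 : 0 ≤ star (b i).ofLp ⬝ᵥ (b i).ofLp := dotProduct_star_self_nonneg _
    exact Complex.ext h1 (Complex.le_def.mp h0).2.symm
  -- A real orthonormal basis has twice as many vectors as a complex one. Expanding both x and ix in
  -- it gives the complex coefficients, by Re z - i Re(iz) = z, and the factor 2 from x - i(ix) =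
  -- 2x.
  · apply Matrix.ext_of_mulVec_single
    intro j
    generalize (Pi.single j 1 : n → ℂ) = x
    have h1 := hre x
    have h2 := hre (Complex.I • x)
    rw [Matrix.smul_mulVec, Matrix.one_mulVec]
    have h3 : x - Complex.I • (Complex.I • x) = (2 : ℂ) • x := by
      rw [smul_smul, Complex.I_mul_I, neg_one_smul, sub_neg_eq_add, two_smul]
    rw [← h3]
    conv_rhs => rw [← h2]; lhs; rw [← h1]
    rw [Matrix.sum_mulVec, Finset.smul_sum, ← Finset.sum_sub_distrib]
    refine Finset.sum_congr rfl fun i _ => ?_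
    rw [proj_mulVec, dotProduct_smul, smul_smul, ← sub_smul]
    congr 1
    generalize star (b i).ofLp ⬝ᵥ x = z
    apply Complex.ext <;> simp
  · intro i
    have h1 := congrArg (fun z : EuclideanSpace ℂ n => star z.ofLp) (hT.apply_eigenvectorBasis rfl i)
    simp only [T, LinearMap.coe_mk, AddHom.coe_mk, star_star] at h1
    rw [h1]
    ext j
    simp [hb]

theorem proj_mulVec_eq {n : Type*} [Fintype n] (A : Matrix n n ℂ) (v : n → ℂ) :
    proj (A.mulVec v) = A * proj v * A.conjTranspose := by
  rw [proj, proj, Matrix.mul_vecMulVec, Matrix.vecMulVec_mul, Matrix.star_mulVec]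

theorem concurrence_mulVec (A : Matrix Qubits Qubits ℂ) (v : Qubits → ℂ) :
    concurrence (A.mulVec v) = ‖v ⬝ᵥ (A.transpose * sigmaYY * A).mulVec v‖ := by
  rw [concurrence_eq, spinFlip, ← star_mulVec_sigmaYY, Matrix.star_dotProduct_star, norm_star,
    dotProduct_comm, Matrix.mul_assoc, ← Matrix.mulVec_mulVec, Matrix.dotProduct_mulVec v,
    Matrix.vecMul_transpose, Matrix.mulVec_mulVec]

theorem isGreatest_avgConcurrences {ρ : Matrix Qubits Qubits ℂ} (hρ : IsState ρ) :
    IsGreatest (avgConcurrences ρ) (fidelity ρ (ptConj sigmaYY 1 ρ)) := by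
  obtain ⟨t, e, hte⟩ := exists_isSpectral hρ.1.1
  have ht := hte.nonneg hρ.1
  set A := CFC.sqrt ρ with hA
  have hApsd : A.PosSemidef := sqrt_posSemidef ρ
  have hAA : A * A = ρ := sqrt_mul_sqrt hρ.1
  have hAt : A.map star = A.transpose := by
    conv_lhs => rw [← hApsd.1.eq]
    ext; simp
  set M := A.transpose * sigmaYY * A with hMdef
  have hM : M.transpose = M := by
    rw [hMdef, Matrix.transpose_mul, Matrix.transpose_mul, sigmaYY_transpose,
      Matrix.transpose_transpose, Matrix.mul_assoc]
  obtain ⟨N, u, μ, hu, hsum, hμ⟩ := exists_coneigenvectors hM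
  set Q := A * ptConj sigmaYY 1 ρ * A with hQ
  have hQpsd : Q.PosSemidef := by
    have := (ptConj_sigmaYY_posSemidef hρ.1).mul_mul_conjTranspose_same A
    rwa [hApsd.1.eq] at this
  have hQM : Q = M.map star * M := by
    have hA2 : A.transpose.map star = A := by rw [← hAt]; ext; simp
    rw [hQ, ptConj_sigmaYY, ← hAA, map_star_mul, hMdef, map_star_mul, map_star_mul,
      sigmaYY_map_star, hA2, hAt]
    simp only [Matrix.mul_assoc]
  have hQu : ∀ i, Q.mulVec (u i) = ((μ i ^ 2 : ℝ) : ℂ) • u i := by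
    intro i
    have h1 : (M.map star).mulVec (star (u i)) = (μ i : ℂ) • u i := by
      rw [← star_mulVec_eq_map_star, hμ]
      simp
    rw [hQM, ← Matrix.mulVec_mulVec, hμ, Matrix.mulVec_smul, h1, smul_smul]
    push_cast
    rw [pow_two]
  have hRu : ∀ i, (CFC.sqrt Q).mulVec (u i) = ((|μ i| : ℝ) : ℂ) • u i := by
    intro i
    obtain ⟨t', e', h'⟩ := exists_isSpectral hQpsd.1
    rw [h'.sqrt_eq hQpsd, cfc_mulVec_of_eigenvector hQpsd.1 (hQu i), Real.sqrt_sq_eq_abs]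
  -- Tr √Q is computed in the frame `u`, which resolves twice the identity; hence the factor 1/2.
  have hF : fidelity ρ (ptConj sigmaYY 1 ρ) = 1 / 2 * ∑ i, |μ i| := by
    have h1 : (CFC.sqrt Q * ((2 : ℂ) • (1 : Matrix Qubits Qubits ℂ))).trace
        = ((∑ i, |μ i| : ℝ) : ℂ) := by
      rw [← hsum, Matrix.mul_sum, Matrix.trace_sum]
      push_cast
      refine Finset.sum_congr rfl fun i _ => ?_
      rw [trace_mul_proj, hRu, dotProduct_smul, hu i, smul_eq_mul, mul_one]
    rw [Matrix.mul_smul, Matrix.mul_one, Matrix.trace_smul, smul_eq_mul] at h1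
    have h2 := congrArg Complex.re h1
    rw [Complex.ofReal_re] at h2
    simp only [Complex.mul_re, Complex.re_ofNat, Complex.im_ofNat, zero_mul, sub_zero] at h2
    rw [fidelity, ← hA, ← hQ]
    linarith
  have hnorm : ‖((Real.sqrt (1 / 2) : ℝ) : ℂ)‖ ^ 2 = 1 / 2 := by
    rw [Complex.norm_real, Real.norm_eq_abs, sq_abs, Real.sq_sqrt (by norm_num)]
  refine ⟨?_, ?_⟩
  -- The optimal decomposition consists of the vectors √ρ u_i / √2.
  · have h1 := sum_concurrence_mem_avgConcurrences hρ
      (fun i => ((Real.sqrt (1 / 2) : ℝ) : ℂ) • A.mulVec (u i)) (by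
        simp only [proj_smul, hnorm, proj_mulVec_eq]
        rw [← Finset.smul_sum, ← Finset.sum_mul, ← Finset.mul_sum, hsum, hApsd.1.eq,
          Matrix.mul_smul, Matrix.mul_one, Matrix.smul_mul, hAA, smul_smul]
        norm_num)
    have h2 : ∀ i, concurrence (A.mulVec (u i)) = |μ i| := by
      intro i
      rw [concurrence_mulVec, ← hMdef, hμ, dotProduct_smul, dotProduct_comm, hu i, smul_eq_mul,
        mul_one, Complex.norm_real, Real.norm_eq_abs]
    simp only [concurrence_smul, hnorm, h2] at h1
    rwa [← Finset.mul_sum, ← hF] at h1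
  · rintro x ⟨m, p, Ψ, ⟨hp, -, -, hdec⟩, rfl⟩
    have hquad : ∀ v, star v ⬝ᵥ ρ.mulVec v = ((∑ k, p k * ‖star (Ψ k) ⬝ᵥ v‖ ^ 2 : ℝ) : ℂ) := by
      intro v
      conv_lhs => rw [hdec]
      exact dotProduct_sum_smul_proj_mulVec p Ψ v
    -- The pseudo-inverse of √ρ, zero on the kernel of ρ. Every Ψ_k of nonzero weight is orthogonal
    -- to that kernel, so `A` undoes `G` on it.
    set G := cfc (fun r : ℝ => (Real.sqrt r)⁻¹) ρ with hG
    have hGh : G.IsHermitian := isHermitian_cfc _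
    have hAG : ∀ k, p k ≠ 0 → A.mulVec (G.mulVec (Ψ k)) = Ψ k := by
      intro k hk
      rw [hA, hte.sqrt_eq hρ.1, Matrix.mulVec_mulVec, hte.mul_cfc Real.sqrt _
        (fun r => Real.sqrt r * (Real.sqrt r)⁻¹) (fun _ => rfl), hte.cfc_eq, sum_smul_proj_mulVec]
      conv_rhs => rw [hte.expand (Ψ k)]
      refine Finset.sum_congr rfl fun i _ => ?_
      rcases (ht i).eq_or_lt with h0 | h0
      · have h1 := hquad (e i)
        rw [hte.mulVec_eigenvector, ← h0, Complex.ofReal_zero, zero_smul, dotProduct_zero] at h1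
        have h2 : ∑ k, p k * ‖star (Ψ k) ⬝ᵥ e i‖ ^ 2 = 0 := by exact_mod_cast h1.symm
        have h3 := (Finset.sum_eq_zero_iff_of_nonneg fun k _ =>
          mul_nonneg (hp k) (sq_nonneg _)).mp h2 k (Finset.mem_univ k)
        have h4 : ‖star (Ψ k) ⬝ᵥ e i‖ = 0 := by simpa [hk] using h3
        rw [norm_star_dotProduct_comm, norm_eq_zero] at h4
        simp [h4]
      · rw [mul_inv_cancel₀ (Real.sqrt_pos.mpr h0).ne', Complex.ofReal_one, one_mul]
    have hbound : ∀ v, ‖v ⬝ᵥ M.mulVec v‖ ≤ 1 / 2 * ∑ i, |μ i| * ‖star (u i) ⬝ᵥ v‖ ^ 2 := by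
      intro v
      have h1 : (2 : ℂ) • v = ∑ i, (star (u i) ⬝ᵥ v) • u i := by
        have := congrArg (fun B : Matrix Qubits Qubits ℂ => B.mulVec v) hsum
        simp only [Matrix.sum_mulVec, proj_mulVec, Matrix.smul_mulVec, Matrix.one_mulVec] at this
        exact this.symm
      have h2 : (2 : ℂ) * (v ⬝ᵥ M.mulVec v) = ∑ i, (μ i : ℂ) * (star (u i) ⬝ᵥ v) ^ 2 := by
        rw [← smul_eq_mul, ← dotProduct_smul, ← Matrix.mulVec_smul, h1, Matrix.mulVec_sum,
          dotProduct_sum]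
        refine Finset.sum_congr rfl fun i _ => ?_
        rw [Matrix.mulVec_smul, hμ, dotProduct_smul, dotProduct_smul, dotProduct_comm v,
          smul_eq_mul, smul_eq_mul]
        ring
      have h3 := norm_sum_le Finset.univ fun i => (μ i : ℂ) * (star (u i) ⬝ᵥ v) ^ 2
      rw [← h2] at h3
      simp only [norm_mul, norm_pow, Complex.norm_real, Real.norm_eq_abs, Complex.norm_ofNat] at h3
      linarith
    -- ∑ p_k |GΨ_k⟩⟨GΨ_k| = GρG is the projection onto the support of ρ, so its expectation in a
    -- unit vector is at most 1.
    have hweight : ∀ i, ∑ k, p k * ‖star (u i) ⬝ᵥ G.mulVec (Ψ k)‖ ^ 2 ≤ 1 := by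
      intro i
      have h1 : ∀ k, ‖star (u i) ⬝ᵥ G.mulVec (Ψ k)‖ = ‖star (Ψ k) ⬝ᵥ G.mulVec (u i)‖ := by
        intro k
        rw [norm_star_dotProduct_comm (Ψ k), Matrix.star_mulVec, hGh.eq, Matrix.dotProduct_mulVec]
      have h2 := hquad (G.mulVec (u i))
      rw [hte.quadForm] at h2
      simp only [h1]
      rw [← Complex.ofReal_inj.mp h2]
      have h3 := hte.sum_norm_sq_of_isUnitVec (hu i)
      rw [← h3]
      refine Finset.sum_le_sum fun j _ => ?_
      rw [hG, hte.dotProduct_cfc_mulVec, norm_mul, Complex.norm_real, Real.norm_eq_abs, mul_pow,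
        sq_abs, inv_pow, Real.sq_sqrt (ht j), ← mul_assoc]
      exact mul_le_of_le_one_left (sq_nonneg _) (mul_inv_le_one)
    calc ∑ k, p k * concurrence (Ψ k)
        ≤ ∑ k, p k * (1 / 2 * ∑ i, |μ i| * ‖star (u i) ⬝ᵥ G.mulVec (Ψ k)‖ ^ 2) := by
          refine Finset.sum_le_sum fun k _ => ?_
          by_cases hk : p k = 0
          · simp [hk]
          · refine mul_le_mul_of_nonneg_left ?_ (hp k)
            conv_lhs => rw [← hAG k hk]
            rw [concurrence_mulVec]
            exact hbound _
      _ = 1 / 2 * ∑ i, |μ i| * ∑ k, p k * ‖star (u i) ⬝ᵥ G.mulVec (Ψ k)‖ ^ 2 := by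
          simp only [Finset.mul_sum]
          rw [Finset.sum_comm]
          exact Finset.sum_congr rfl fun i _ => Finset.sum_congr rfl fun k _ => by ring
      _ ≤ 1 / 2 * ∑ i, |μ i| := by
          refine mul_le_mul_of_nonneg_left (Finset.sum_le_sum fun i _ => ?_) (by norm_num)
          exact mul_le_of_le_one_right (abs_nonneg _) (hweight i)
      _ = fidelity ρ (ptConj sigmaYY 1 ρ) := hF.symm

end Assistance


/-! ### Compactness of convex hulls -/

section ConvexHull

/-- In finite dimension, the convex hull of a compact set is compact. -/
theorem isCompact_convexHull_of_isCompact {E : Type*} [AddCommGroup E] [Module ℝ E]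
    [TopologicalSpace E] [ContinuousAdd E] [ContinuousSMul ℝ E] [FiniteDimensional ℝ E]
    {s : Set E} (hs : IsCompact s) : IsCompact (convexHull ℝ s) := by
  rcases s.eq_empty_or_nonempty with rfl | ⟨x₀, hx₀⟩
  · simp
  -- Carathéodory's bound: N points suffice, so the hull is a continuous image of a simplex times `s
  -- ^ N`.
  let N := Module.finrank ℝ E + 1
  have hK : IsCompact (stdSimplex ℝ (Fin N) ×ˢ Set.pi Set.univ fun _ : Fin N => s) :=
    (isCompact_stdSimplex ℝ (Fin N)).prod (isCompact_univ_pi fun _ => hs)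
  have hf : Continuous fun q : (Fin N → ℝ) × (Fin N → E) => ∑ i, q.1 i • q.2 i := by
    fun_prop
  convert hK.image hf using 1
  ext x
  constructor
  · intro hx
    obtain ⟨ι, _, z, w, hz, hind, hw, hw1, rfl⟩ := eq_pos_convex_span_of_mem_convexHull hx
    have hcard : Fintype.card ι ≤ Fintype.card (Fin N) := by
      rw [Fintype.card_fin]
      exact hind.card_le_finrank_succ.trans (Nat.succ_le_succ (Submodule.finrank_le _))
    obtain ⟨g⟩ := Function.Embedding.nonempty_of_card_le hcard
    -- Shorter combinations are padded with weight 0 at `x₀`.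
    refine ⟨(Function.extend g w 0, Function.extend g z fun _ => x₀), ⟨⟨?_, ?_⟩, ?_⟩, ?_⟩
    · intro j
      by_cases hj : ∃ i, g i = j
      · obtain ⟨i, rfl⟩ := hj
        simpa [g.injective.extend_apply] using (hw i).le
      · simp [Function.extend_apply' _ _ _ hj]
    · rw [← hw1]
      exact (Fintype.sum_of_injective g g.injective w _
        (fun j hj => by simp [Function.extend_apply' _ _ _ hj])
        (fun i => by simp [g.injective.extend_apply])).symm
    · intro j _
      by_cases hj : ∃ i, g i = j
      · obtain ⟨i, rfl⟩ := hj
        simpa [g.injective.extend_apply] using hz ⟨i, rfl⟩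
      · simpa [Function.extend_apply' _ _ _ hj] using hx₀
    · exact (Fintype.sum_of_injective g g.injective (fun i => w i • z i) _
        (fun j hj => by simp [Function.extend_apply' _ _ _ hj])
        (fun i => by simp [g.injective.extend_apply])).symm
  · rintro ⟨⟨w, z⟩, ⟨⟨hw0, hw1⟩, hz⟩, rfl⟩
    exact mem_convexHull_of_exists_fintype w z hw0 hw1 (fun i => hz i trivial) rfl

end ConvexHull

/-! ### Attainment of the least average concurrence; fidelity of pure states -/

section Attainment

theorem isCompact_isUnitVec {n : Type*} [Fintype n] : IsCompact {ψ : n → ℂ | IsUnitVec ψ} := by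
  refine Metric.isCompact_of_isClosed_isBounded ?_ ?_
  · exact isClosed_eq (by fun_prop) continuous_const
  · refine (Metric.isBounded_closedBall (x := (0 : n → ℂ)) (r := 1)).subset fun ψ hψ => ?_
    rw [mem_closedBall_zero_iff, pi_norm_le_iff_of_nonneg zero_le_one]
    intro i
    have h1 : ∑ j, ‖ψ j‖ ^ 2 = 1 := by
      have h2 : star ψ ⬝ᵥ ψ = 1 := hψ
      have h3 : star ψ ⬝ᵥ ψ = ((∑ j, ‖ψ j‖ ^ 2 : ℝ) : ℂ) := by
        push_cast
        exact Finset.sum_congr rfl fun j _ => Complex.conj_mul' (ψ j)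
      rw [h3] at h2
      exact_mod_cast h2
    have h4 := Finset.single_le_sum (f := fun j => ‖ψ j‖ ^ 2) (fun j _ => sq_nonneg _)
      (Finset.mem_univ i)
    rw [h1] at h4
    exact (sq_le_one_iff₀ (norm_nonneg _)).mp h4

/-- Decompositions have unbounded length; read as points of a convex hull in a finite-dimensional
space, they come under a compactness argument. -/
theorem mem_avgConcurrences_iff {ρ : Matrix Qubits Qubits ℂ} (hρ : IsState ρ) (x : ℝ) :
    x ∈ avgConcurrences ρ ↔ (x, ρ) ∈ convexHull ℝ
      ((fun ψ : Qubits → ℂ => (concurrence ψ, proj ψ)) '' {ψ | IsUnitVec ψ}) := by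
  constructor
  · rintro ⟨m, p, Ψ, ⟨hp, hp1, hΨ, hdec⟩, rfl⟩
    refine mem_convexHull_of_exists_fintype p (fun k => (concurrence (Ψ k), proj (Ψ k))) hp hp1
      (fun k => ⟨Ψ k, hΨ k, rfl⟩) ?_
    refine Prod.ext ?_ ?_
    · simp [Prod.fst_sum]
    · rw [Prod.snd_sum, hdec]
      rfl
  · intro hx
    obtain ⟨ι, _, w, z, hw, -, hz, hsum⟩ := mem_convexHull_iff_exists_fintype.mp hx
    choose ψ _ hψ using hz
    have hn : ∀ i, ‖((Real.sqrt (w i) : ℝ) : ℂ)‖ ^ 2 = w i := by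
      intro i
      rw [Complex.norm_real, Real.norm_eq_abs, sq_abs, Real.sq_sqrt (hw i)]
    have h1 := congrArg Prod.fst hsum
    have h2 := congrArg Prod.snd hsum
    simp only [← hψ, Prod.fst_sum, Prod.snd_sum, Prod.smul_mk, smul_eq_mul] at h1 h2
    have h3 := sum_concurrence_mem_avgConcurrences hρ
      (fun i => ((Real.sqrt (w i) : ℝ) : ℂ) • ψ i) (by
        simp only [proj_smul, hn]
        rw [← h2]
        rfl)
    simp only [concurrence_smul, hn] at h3
    rwa [h1] at h3

/-- The averages are a slice of a compact hull, hence closed; they are bounded below by 0, and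
nonempty since the maximum is attained. -/
theorem isLeast_avgConcurrences {ρ : Matrix Qubits Qubits ℂ} (hρ : IsState ρ) :
    IsLeast (avgConcurrences ρ) (mixedConcurrence ρ) := by
  have hcont : Continuous fun ψ : Qubits → ℂ => (concurrence ψ, proj ψ) := by
    unfold concurrence proj
    fun_prop
  have hclosed : IsClosed (avgConcurrences ρ) := by
    have h := (isCompact_convexHull_of_isCompact
      ((isCompact_isUnitVec (n := Qubits)).image hcont)).isClosed
    have h' := h.preimage (f := fun x : ℝ => (x, ρ)) (by fun_prop)
    convert h' using 1
    ext x
    exact mem_avgConcurrences_iff hρ x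
  have hbdd : BddBelow (avgConcurrences ρ) := ⟨0, fun _ => nonneg_of_mem_avgConcurrences⟩
  exact ⟨hclosed.csInf_mem ⟨_, (isGreatest_avgConcurrences hρ).1⟩ hbdd,
    fun _ hx => csInf_le hbdd hx⟩

theorem concurrenceOfAssistance_eq_fidelity {ρ : Matrix Qubits Qubits ℂ} (hρ : IsState ρ) :
    concurrenceOfAssistance ρ = fidelity ρ (ptConj sigmaYY 1 ρ) :=
  (isGreatest_avgConcurrences hρ).csSup_eq

theorem gammaF_proj {ψ : Qubits → ℂ} (hψ : IsUnitVec ψ) :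
    gammaF sigmaYY 1 (proj ψ) + concurrence ψ = 1 := by
  have hsq : CFC.sqrt (proj ψ * ptConj sigmaYY 1 (proj ψ) * proj ψ)
      = ((concurrence ψ : ℝ) : ℂ) • proj ψ := by
    refine sqrt_eq_of_mul_self
      ((proj_posSemidef ψ).smul (Complex.zero_le_real.mpr (concurrence_nonneg ψ))) ?_
    have h' : star ψ ⬝ᵥ ψ = 1 := hψ
    have h1 : proj ψ * proj ψ = proj ψ := by rw [proj_mul_proj, h', one_smul, proj]
    have h2 : proj ψ * proj (spinFlip ψ) * proj ψ
        = ((concurrence ψ * concurrence ψ : ℝ) : ℂ) • proj ψ := by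
      rw [proj_mul_proj, Matrix.smul_mul, proj, Matrix.vecMulVec_mul_vecMulVec,
        Matrix.vecMulVec_smul, smul_smul, conj_mul_dotProduct, norm_star_dotProduct_comm, pow_two,
        concurrence_eq]
    rw [ptConj_sigmaYY_proj, h2, Matrix.smul_mul, Matrix.mul_smul, h1, smul_smul,
      Complex.ofReal_mul]
  rw [gammaF, fidelity, hψ.sqrt_proj, hsq, Matrix.trace_smul, trace_proj, hψ, smul_eq_mul, mul_one,
    Complex.ofReal_re]
  ring

end Attainment

/-! ### The maximally mixed state as an example of strictness -/

section MaximallyMixed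

theorem isState_maximallyMixed :
    IsState (((1 / 4 : ℝ) : ℂ) • (1 : Matrix Qubits Qubits ℂ)) := by
  refine ⟨Matrix.PosSemidef.one.smul (Complex.zero_le_real.mpr (by norm_num)), ?_⟩
  rw [Matrix.trace_smul, Matrix.trace_one]
  norm_num

theorem ptConj_maximallyMixed (c : ℝ) :
    ptConj sigmaYY 1 ((c : ℂ) • (1 : Matrix Qubits Qubits ℂ)) = (c : ℂ) • 1 := by
  rw [ptConj_sigmaYY_smul, ptConj_sigmaYY, Matrix.map_one _ (star_zero _) (star_one _),
    Matrix.mul_one, sigmaYY_mul_self]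

theorem mixedConcurrence_maximallyMixed :
    mixedConcurrence (((1 / 4 : ℝ) : ℂ) • (1 : Matrix Qubits Qubits ℂ)) = 0 := by
  refine le_antisymm ?_ (mixedConcurrence_nonneg _)
  have hn : ‖((1 / 2 : ℝ) : ℂ)‖ ^ 2 = 1 / 4 := by
    rw [Complex.norm_real, Real.norm_eq_abs, sq_abs]; norm_num
  -- The standard basis consists of product vectors, whose concurrence is zero.
  have h := sum_concurrence_mem_avgConcurrences isState_maximallyMixed
    (fun i : Qubits => ((1 / 2 : ℝ) : ℂ) • (Pi.single i 1 : Qubits → ℂ)) (by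
      simp only [proj_smul, hn]
      rw [← Finset.smul_sum]
      congr 1
      ext i j
      simp [Matrix.sum_apply, proj, Matrix.vecMulVec_apply, Matrix.one_apply, Pi.single_apply])
  have h0 : ∀ i : Qubits, concurrence (Pi.single i 1) = 0 := by
    rintro ⟨i, j⟩
    have : star (Pi.single (i, j) 1 : Qubits → ℂ) = Pi.single (i, j) 1 := by
      ext k
      simp [Pi.single_apply, apply_ite]
    rw [concurrence, this, Matrix.mulVec_single_one, single_one_dotProduct]
    fin_cases i <;> fin_cases j <;> simp [sigmaYY, sigmaY]
  simp only [concurrence_smul, h0, mul_zero, Finset.sum_const_zero] at h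
  exact mixedConcurrence_le h

theorem sqrt_maximallyMixed :
    CFC.sqrt (((1 / 4 : ℝ) : ℂ) • (1 : Matrix Qubits Qubits ℂ))
      = ((1 / 2 : ℝ) : ℂ) • (1 : Matrix Qubits Qubits ℂ) := by
  refine sqrt_eq_of_mul_self
    (Matrix.PosSemidef.one.smul (Complex.zero_le_real.mpr (by norm_num))) ?_
  rw [Matrix.smul_mul, Matrix.one_mul, smul_smul]
  norm_num

theorem gammaS_maximallyMixed :
    gammaS sigmaYY 1 (((1 / 4 : ℝ) : ℂ) • (1 : Matrix Qubits Qubits ℂ)) = 0 := by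
  rw [gammaS, sqrt_maximallyMixed, ptConj_maximallyMixed, Matrix.smul_mul, Matrix.one_mul, smul_smul,
    Matrix.trace_smul, Matrix.trace_one]
  norm_num

theorem gammaF_maximallyMixed :
    gammaF sigmaYY 1 (((1 / 4 : ℝ) : ℂ) • (1 : Matrix Qubits Qubits ℂ)) = 0 := by
  have h : ((1 / 2 : ℝ) : ℂ) • (1 : Matrix Qubits Qubits ℂ) * (((1 / 4 : ℝ) : ℂ) • 1)
      * (((1 / 2 : ℝ) : ℂ) • 1)
      = (((1 / 4 : ℝ) : ℂ) • (1 : Matrix Qubits Qubits ℂ)) * (((1 / 4 : ℝ) : ℂ) • 1) := by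
    simp only [Matrix.smul_mul, Matrix.mul_smul, Matrix.one_mul, smul_smul]
    norm_num
  rw [gammaF, fidelity, ptConj_maximallyMixed, sqrt_maximallyMixed, h,
    sqrt_eq_of_mul_self isState_maximallyMixed.1 rfl, Matrix.trace_smul, Matrix.trace_one]
  norm_num

theorem gammaR_maximallyMixed :
    gammaR sigmaYY 1 (((1 / 4 : ℝ) : ℂ) • (1 : Matrix Qubits Qubits ℂ)) ≤ 0 := by
  refine (iInf₂_le _ ⟨isState_maximallyMixed, ptConj_maximallyMixed _⟩).trans ?_
  rw [relEntropy, if_pos fun _ h => h, sub_self]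
  exact le_rfl

theorem binH_one_half : binH (1 / 2) = 1 := by
  rw [binH_eq, one_div, Real.binEntropy_two_inv, div_self (Real.log_pos one_lt_two).ne']

end MaximallyMixed

end PTAsym

theorem theorem1 :
    -- pure two-qubit states
    (∀ Ψ : Fin 2 × Fin 2 → ℂ, IsUnitVec Ψ →
      gammaS sigmaYY 1 (proj Ψ) + concurrence Ψ ^ 2 = 1 ∧
      gammaF sigmaYY 1 (proj Ψ) + concurrence Ψ = 1 ∧
      gammaR sigmaYY 1 (proj Ψ) = ((binH (1 / 2 - 1 / 2 * concurrence Ψ) : ℝ) : EReal)) ∧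
    -- arbitrary two-qubit states
    (∀ ρ : Matrix (Fin 2 × Fin 2) (Fin 2 × Fin 2) ℂ, IsState ρ →
      -- the extrema in the definitions are attained
      (∃ σ ∈ symStates sigmaYY 1, relEntropy ρ σ = gammaR sigmaYY 1 ρ) ∧
      IsLeast (avgConcurrences ρ) (mixedConcurrence ρ) ∧
      IsGreatest (avgConcurrences ρ) (concurrenceOfAssistance ρ) ∧
      -- inequalities
      gammaS sigmaYY 1 ρ + mixedConcurrence ρ ^ 2 ≤ 1 ∧
      gammaF sigmaYY 1 ρ + mixedConcurrence ρ ≤ 1 ∧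
      gammaR sigmaYY 1 ρ ≤ ((binH (1 / 2 - 1 / 2 * mixedConcurrence ρ) : ℝ) : EReal) ∧
      -- duality with the concurrence of assistance
      gammaF sigmaYY 1 ρ + concurrenceOfAssistance ρ = 1) ∧
    -- the three equalities can fail for a mixed state
    (∃ ρ : Matrix (Fin 2 × Fin 2) (Fin 2 × Fin 2) ℂ, IsState ρ ∧
      gammaS sigmaYY 1 ρ + mixedConcurrence ρ ^ 2 ≠ 1 ∧
      gammaF sigmaYY 1 ρ + mixedConcurrence ρ ≠ 1 ∧
      gammaR sigmaYY 1 ρ ≠ ((binH (1 / 2 - 1 / 2 * mixedConcurrence ρ) : ℝ) : EReal)) := by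
  refine ⟨fun Ψ hΨ => ⟨gammaS_proj hΨ, gammaF_proj hΨ, gammaR_proj hΨ⟩, fun ρ hρ => ?_, ?_⟩
  · have hF : gammaF sigmaYY 1 ρ + concurrenceOfAssistance ρ = 1 := by
      rw [gammaF, concurrenceOfAssistance_eq_fidelity hρ]
      ring
    have hG : IsGreatest (avgConcurrences ρ) (concurrenceOfAssistance ρ) := by
      rw [concurrenceOfAssistance_eq_fidelity hρ]
      exact isGreatest_avgConcurrences hρ
    have hL := isLeast_avgConcurrences hρ
    refine ⟨⟨symPart ρ, symPart_mem_symStates hρ, relEntropy_symPart_eq_gammaR hρ⟩, hL, hG,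
      gammaS_add_sq_le hρ, ?_, gammaR_le hρ, hF⟩
    -- The duality together with C(ρ) ≤ CoA(ρ).
    linarith [hL.2 hG.1]
  · refine ⟨((1 / 4 : ℝ) : ℂ) • 1, isState_maximallyMixed, ?_, ?_, ?_⟩
    · rw [gammaS_maximallyMixed, mixedConcurrence_maximallyMixed]
      norm_num
    · rw [gammaF_maximallyMixed, mixedConcurrence_maximallyMixed]
      norm_num
    · rw [mixedConcurrence_maximallyMixed, mul_zero, sub_zero, binH_one_half]
      exact (gammaR_maximallyMixed.trans_lt (by exact_mod_cast zero_lt_one)).ne
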